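/- All spaces are over $\mathbb{C}$. An operator space is a normed space $X$ with norms on all the matrix spaces $M_n(X)$ (the given norm for $n=1$) such that $\|x\oplus y\|=\max\{\|x\|,\|y\|\}$ and $\|\alpha x\beta\|\le\|\alpha\|\,\|x\|\,\|\beta\|$ for scalar matrices $\alpha,\beta$; rectangular matrices are normed by completing them with zeros to square ones. The dual $X^*$ is an operator space through $M_n(X^*)=CB(X,M_n)$. A dual operator space is an operator space $X$ with a completely isometric identification $X=(X_*)^*$ for a (norm complete) operator space $X_*$. A projection is a linear idempotent map. A projection $P$ on $X$ is a complete left $M$-projection if for all $n$ and $x\in M_n(X)$ $$\|x\|=\left\|\begin{bmatrix}P_n(x)\\ x-P_n(x)\end{bmatrix}\right\|_{M_{2n,n}(X)},$$ where $P_n$ acts entrywise; it is a complete right $L$-projection if $x\mapsto[P(x)\ \ x-P(x)]$ is a complete isometry of $X$ into $R_2[X]=R_2\hat\otimes X$, where $R_2=M_{1,2}(\mathbb{C})$ and $\hat\otimes$ is the operator space projective tensor product. A complete right $M$-summand of $X$ is the range of a complete left $M$-projection on $X$; a complete left $L$-summand is the range of a complete right $L$-projection; a complete right $M$-ideal of $X$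 is a closed subspace $J$ such that $J^{\perp\perp}$ is a complete right $M$-summand of $X^{**}$. A Banach space is a dual Banach space if it is isometrically isomorphic to the dual of a Banach space. **Theorem.** Let $X$ be an operator space. (a) Let $P$ be a complete left $M$-projection on $X$. If $Q$ is a contractive projection on $X$ with $\operatorname{Ran}Q=\operatorname{Ran}P$, then $P=Q$. (b) Let $P$ be a complete right $L$-projection on $X$. If $Q$ is a contractive projection on $X$ with $\ker Q=\ker P$, then $Q=P$. (c) If there is a contractive projection from $X$ onto a complete right $M$-ideal $J$ of $X$, then $J$ is a complete right $M$-summand of $X$, and the contractive projection of $X$ onto $J$ is unique. (d) If $J$ is a complete right $M$-ideal of $X$ and $J$ is a dual Banach space, then $J$ is a complete right $M$-summand of $X$. (e) If $X$ is a dual operator space and $J$ is a weak*-closed complete right $M$-ideal of $X$, then $J$ is a complete right $M$-summand of $X$, and $J$ is the annihilator of a complete left $L$-summand of $X_*$. -/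

import Mathlib

open scoped Matrix.Norms.L2Operator

noncomputable section

/-- The matrix `α x β` for scalar matrices `α`, `β` and a matrix `x` over a vector space. -/
def matSandwich {X : Type*} [AddCommGroup X] [Module ℂ X] {a b c d : Type*} [Fintype b]
    [Fintype c] (α : Matrix a b ℂ) (x : Matrix b c X) (β : Matrix c d ℂ) : Matrix a d X :=
  Matrix.of fun i j => ∑ k, ∑ l, (α i k * β l j) • x k l

/-- The square matrix with blocks `x y` in the first row and `z w` in the second row. -/
def matBlocks {X : Type*} {m n : ℕ} (x : Matrix (Fin m) (Fin m) X) (y : Matrix (Fin m) (Fin n) X)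
    (z : Matrix (Fin n) (Fin m) X) (w : Matrix (Fin n) (Fin n) X) :
    Matrix (Fin (m + n)) (Fin (m + n)) X :=
  Matrix.reindex finSumFinEquiv finSumFinEquiv (Matrix.fromBlocks x y z w)

/-- An (abstract) operator space: a complex normed space `X` with a norm `matNorm n` on every
`M_n(X)`, equal to the given norm for `n = 1`, such that `‖x ⊕ y‖ = max ‖x‖ ‖y‖` and
`‖α x β‖ ≤ ‖α‖ ‖x‖ ‖β‖`. Scalar matrices carry the operator norm between Euclidean spaces.
The seminorms `matNorm n` are norms (see `OperatorSpace.eq_zero_of_matNorm_eq_zero`). -/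
class OperatorSpace (X : Type*) [NormedAddCommGroup X] [NormedSpace ℂ X] where
  matNorm : ∀ n : ℕ, Seminorm ℂ (Matrix (Fin n) (Fin n) X)
  matNorm_one : ∀ x : X, matNorm 1 (Matrix.of fun _ _ => x) = ‖x‖
  matNorm_directSum : ∀ (m n : ℕ) (x : Matrix (Fin m) (Fin m) X) (y : Matrix (Fin n) (Fin n) X),
    matNorm (m + n) (matBlocks x 0 0 y) = max (matNorm m x) (matNorm n y)
  matNorm_sandwich_le : ∀ (m n : ℕ) (α : Matrix (Fin n) (Fin m) ℂ)
    (x : Matrix (Fin m) (Fin m) X) (β : Matrix (Fin m) (Fin n) ℂ),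
    matNorm n (matSandwich α x β) ≤ ‖α‖ * matNorm m x * ‖β‖

namespace OperatorSpace

section ScalarMatrices

variable {a b c d : Type*} [Fintype a] [Fintype b] [Fintype c] [Fintype d]
  [DecidableEq a] [DecidableEq b] [DecidableEq c] [DecidableEq d]

set_option linter.unusedSectionVars false

lemma l2_le_of_sq (A : Matrix a b ℂ) (C : ℝ) (hC : 0 ≤ C)
    (h : ∀ v : b → ℂ, ∑ i, ‖A.mulVec v i‖ ^ 2 ≤ C ^ 2 * ∑ j, ‖v j‖ ^ 2) : ‖A‖ ≤ C := by
  rw [Matrix.l2_opNorm_def]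
  refine ContinuousLinearMap.opNorm_le_bound _ hC fun x => ?_
  refine (sq_le_sq₀ (norm_nonneg _) (by positivity)).mp ?_
  rw [mul_pow, EuclideanSpace.norm_sq_eq, EuclideanSpace.norm_sq_eq]
  exact h x.ofLp

lemma sq_le_l2 (A : Matrix a b ℂ) (v : b → ℂ) :
    ∑ i, ‖A.mulVec v i‖ ^ 2 ≤ ‖A‖ ^ 2 * ∑ j, ‖v j‖ ^ 2 := by
  have h := Matrix.l2_opNorm_mulVec A (WithLp.toLp 2 v)
  have h2 := (sq_le_sq₀ (norm_nonneg _) (by positivity)).mpr h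
  rw [mul_pow, EuclideanSpace.norm_sq_eq, EuclideanSpace.norm_sq_eq] at h2
  exact h2

lemma l2_kron_one_le (A : Matrix a b ℂ) :
    ‖(Matrix.of fun (p : a × c) (q : b × c) => if p.2 = q.2 then A p.1 q.1 else 0 :
      Matrix (a × c) (b × c) ℂ)‖ ≤ ‖A‖ := by
  refine l2_le_of_sq _ _ (norm_nonneg _) fun v => ?_
  rw [Fintype.sum_prod_type_right, Fintype.sum_prod_type_right, Finset.mul_sum]
  refine Finset.sum_le_sum fun k _ => ?_
  refine le_trans (le_of_eq ?_) (sq_le_l2 A fun j => v (j, k))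
  refine Finset.sum_congr rfl fun i _ => ?_
  congr 2
  simp [Matrix.mulVec, dotProduct, Fintype.sum_prod_type]

lemma l2_submatrix_le (A : Matrix a b ℂ) (e : c → a) (e' : d → b) (he : Function.Injective e)
    (he' : Function.Injective e') : ‖A.submatrix e e'‖ ≤ ‖A‖ := by
  refine l2_le_of_sq _ _ (norm_nonneg _) fun v => ?_
  set v' : b → ℂ := Function.extend e' v 0
  have hv : ∀ j, v' (e' j) = v j := fun j => he'.extend_apply v (0 : b → ℂ) j
  have hv0 : ∀ k, k ∉ Set.range e' → v' k = 0 := fun k hk =>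
    Function.extend_apply' v (0 : b → ℂ) k hk
  have h2 : ∑ j, ‖v j‖ ^ 2 = ∑ j, ‖v' j‖ ^ 2 :=
    Finset.sum_of_injOn e' he'.injOn (by simp) (fun k _ hk => by rw [hv0 k (by simpa using hk)]; simp)
      fun j _ => by rw [hv]
  have h1 : ∀ i, (A.submatrix e e').mulVec v i = A.mulVec v' (e i) :=
    fun i => Finset.sum_of_injOn e' he'.injOn (by simp)
      (fun k _ hk => by rw [hv0 k (by simpa using hk)]; simp) fun j _ => by rw [hv]; rfl
  rw [h2]
  refine le_trans ?_ (sq_le_l2 A _)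
  simp only [h1]
  refine le_of_eq_of_le
    (Finset.sum_map Finset.univ ⟨e, he⟩ fun i => ‖A.mulVec v' i‖ ^ 2).symm ?_
  exact Finset.sum_le_sum_of_subset_of_nonneg (Finset.subset_univ _) fun _ _ _ => by positivity

lemma l2_block_le (A : Matrix c d ℂ) (i : a) (j : b) :
    ‖(Matrix.of fun (p : a × c) (q : b × d) => if p.1 = i ∧ q.1 = j then A p.2 q.2 else 0 :
      Matrix (a × c) (b × d) ℂ)‖ ≤ ‖A‖ := by
  refine l2_le_of_sq _ _ (norm_nonneg _) fun v => ?_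
  rw [Fintype.sum_prod_type, Finset.sum_eq_single i]
  · refine le_trans (le_of_eq ?_) ((sq_le_l2 A fun l => v (j, l)).trans ?_)
    · refine Finset.sum_congr rfl fun k _ => ?_
      congr 2
      simp only [Matrix.mulVec, dotProduct, Matrix.of_apply, true_and, Fintype.sum_prod_type]
      rw [Finset.sum_eq_single j] <;> simp +contextual
    · rw [Fintype.sum_prod_type]
      gcongr
      exact Finset.single_le_sum (f := fun j => ∑ l, ‖v (j, l)‖ ^ 2)
        (fun _ _ => by positivity) (Finset.mem_univ j)
  · intro i' _ hi
    refine Finset.sum_eq_zero fun k _ => ?_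
    simp [Matrix.mulVec, dotProduct, hi]
  · simp

lemma l2_column (v : a → ℂ) :
    ‖(Matrix.of fun i (_ : Fin 1) => v i : Matrix a (Fin 1) ℂ)‖ ^ 2 ≤ ∑ i, ‖v i‖ ^ 2 := by
  have h0 : 0 ≤ ∑ i, ‖v i‖ ^ 2 := by positivity
  have : ‖(Matrix.of fun i (_ : Fin 1) => v i : Matrix a (Fin 1) ℂ)‖ ≤
      Real.sqrt (∑ i, ‖v i‖ ^ 2) := by
    refine l2_le_of_sq _ _ (Real.sqrt_nonneg _) fun w => ?_
    rw [Real.sq_sqrt h0]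
    simp [Matrix.mulVec, dotProduct, mul_pow, Finset.sum_mul]
  calc _ ≤ Real.sqrt (∑ i, ‖v i‖ ^ 2) ^ 2 := by gcongr
    _ = _ := Real.sq_sqrt h0

lemma l2_row (v : a → ℂ) :
    ‖(Matrix.of fun (_ : Fin 1) i => star (v i) : Matrix (Fin 1) a ℂ)‖ ^ 2 ≤
      ∑ i, ‖v i‖ ^ 2 := by
  have h : (Matrix.of fun (_ : Fin 1) i => star (v i) : Matrix (Fin 1) a ℂ) =
      (Matrix.of fun i (_ : Fin 1) => v i : Matrix a (Fin 1) ℂ).conjTranspose := by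
    ext i j; simp [Matrix.conjTranspose_apply]
  rw [h, Matrix.l2_opNorm_conjTranspose]
  exact l2_column v

end ScalarMatrices

variable {X : Type*} [NormedAddCommGroup X] [NormedSpace ℂ X] [OperatorSpace X]

lemma norm_entry_le {n : ℕ} (x : Matrix (Fin n) (Fin n) X) (i j : Fin n) :
    ‖x i j‖ ≤ matNorm n x := by
  have h := matNorm_sandwich_le n 1
    (Matrix.of fun (_ : Fin 1) k => star (if k = i then (1 : ℂ) else 0))
    x (Matrix.of fun k (_ : Fin 1) => if k = j then (1 : ℂ) else 0)
  have e : matSandwich (Matrix.of fun (_ : Fin 1) k => star (if k = i then (1 : ℂ) else 0))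
      x (Matrix.of fun k (_ : Fin 1) => if k = j then (1 : ℂ) else 0) =
      (Matrix.of fun _ _ => x i j : Matrix (Fin 1) (Fin 1) X) := by
    ext s t
    simp only [matSandwich, Matrix.of_apply]
    rw [Finset.sum_eq_single i, Finset.sum_eq_single j] <;> simp +contextual
  rw [e, matNorm_one] at h
  have s1 : ∀ i : Fin n, ∑ k, ‖(if k = i then (1 : ℂ) else 0)‖ ^ 2 = 1 := by
    intro i
    rw [Finset.sum_eq_single i] <;> simp +contextual
  have h1 := l2_row fun k => if k = i then (1 : ℂ) else 0
  have h2 := l2_column fun k => if k = j then (1 : ℂ) else 0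
  rw [s1] at h1 h2
  have h1' := (sq_le_one_iff₀ (norm_nonneg _)).mp h1
  have h2' := (sq_le_one_iff₀ (norm_nonneg _)).mp h2
  have h0 := apply_nonneg (matNorm (X := X) n) x
  refine h.trans ?_
  calc _ ≤ 1 * matNorm n x * 1 := by gcongr
    _ = _ := by ring

lemma eq_zero_of_matNorm_eq_zero {n : ℕ} (x : Matrix (Fin n) (Fin n) X) (h : matNorm n x = 0) :
    x = 0 := by
  ext i j
  have := norm_entry_le x i j
  rw [h] at this
  simpa using this

/-- The scalar matrix `[f_ij(x_kl)]` in `M_n(M_m) = M_nm` for `f ∈ M_n(X*)`, `x ∈ M_m(X)`. -/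
def matPairing {m n : ℕ} (f : Matrix (Fin n) (Fin n) (StrongDual ℂ X))
    (x : Matrix (Fin m) (Fin m) X) : Matrix (Fin n × Fin m) (Fin n × Fin m) ℂ :=
  Matrix.of fun p q => f p.1 q.1 (x p.2 q.2)

/-- The values whose supremum is the completely bounded norm of `x ↦ [f_ij(x)]`, `X → M_n`. -/
def dualNormSet {n : ℕ} (f : Matrix (Fin n) (Fin n) (StrongDual ℂ X)) : Set ℝ :=
  {r | ∃ (m : ℕ) (x : Matrix (Fin m) (Fin m) X), matNorm m x ≤ 1 ∧ r = ‖matPairing f x‖}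

lemma norm_functional_le (f : StrongDual ℂ X) {m : ℕ} (x : Matrix (Fin m) (Fin m) X) :
    ‖(Matrix.of fun k l => f (x k l) : Matrix (Fin m) (Fin m) ℂ)‖ ≤ ‖f‖ * matNorm m x := by
  have hx0 := apply_nonneg (matNorm (X := X) m) x
  refine l2_le_of_sq _ _ (by positivity) fun v => ?_
  set w := (Matrix.of fun k l => f (x k l) : Matrix (Fin m) (Fin m) ℂ).mulVec v with hw
  set S := ∑ i, ‖w i‖ ^ 2 with hS
  set T := ∑ j, ‖v j‖ ^ 2 with hT
  have hS0 : 0 ≤ S := by positivity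
  have hT0 : 0 ≤ T := by positivity
  have h := matNorm_sandwich_le m 1 (Matrix.of fun (_ : Fin 1) k => star (w k)) x
    (Matrix.of fun l (_ : Fin 1) => v l)
  set z : X := ∑ k, ∑ l, (star (w k) * v l) • x k l with hz
  have e : matSandwich (Matrix.of fun (_ : Fin 1) k => star (w k)) x
      (Matrix.of fun l (_ : Fin 1) => v l) = (Matrix.of fun _ _ => z) := by
    ext s t; simp [matSandwich, hz]
  rw [e, matNorm_one] at h
  have hfz : f z = (S : ℂ) := by
    rw [hz, hS, map_sum, Complex.ofReal_sum]
    refine Finset.sum_congr rfl fun k _ => ?_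
    rw [map_sum]
    have : ∀ l, f ((star (w k) * v l) • x k l) = star (w k) * (f (x k l) * v l) := fun l => by
      rw [map_smul, smul_eq_mul]; ring
    simp only [this]
    rw [← Finset.mul_sum]
    change star (w k) * w k = _
    rw [Complex.ofReal_pow, ← Complex.conj_mul']
    rfl
  have hSz : S ≤ ‖f‖ * ‖z‖ := by
    have := f.le_opNorm z
    rw [hfz, Complex.norm_real, Real.norm_of_nonneg hS0] at this
    exact this
  have hr := l2_row w
  have hc := l2_column v
  set r := ‖(Matrix.of fun (_ : Fin 1) k => star (w k) : Matrix (Fin 1) (Fin m) ℂ)‖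
  set c := ‖(Matrix.of fun l (_ : Fin 1) => v l : Matrix (Fin m) (Fin 1) ℂ)‖
  have hr0 : 0 ≤ r := norm_nonneg _
  have hc0 : 0 ≤ c := norm_nonneg _
  have h3 : S ≤ ‖f‖ * (r * matNorm m x * c) := hSz.trans (by gcongr)
  rcases hS0.eq_or_lt with h0 | h0
  · rw [← h0]; positivity
  · have h4 : S ^ 2 ≤ S * ((‖f‖ * matNorm m x) ^ 2 * T) := by
      calc S ^ 2 ≤ (‖f‖ * (r * matNorm m x * c)) ^ 2 := by gcongr
        _ = r ^ 2 * ((‖f‖ * matNorm m x) ^ 2 * c ^ 2) := by ring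
        _ ≤ S * ((‖f‖ * matNorm m x) ^ 2 * T) := by gcongr
    rw [sq] at h4
    exact le_of_mul_le_mul_left h4 h0

lemma norm_matPairing_le_sum {m n : ℕ} (f : Matrix (Fin n) (Fin n) (StrongDual ℂ X))
    (x : Matrix (Fin m) (Fin m) X) :
    ‖matPairing f x‖ ≤ (∑ i, ∑ j, ‖f i j‖) * matNorm m x := by
  have e : matPairing f x = ∑ i, ∑ j, (Matrix.of fun (p q : Fin n × Fin m) =>
      if p.1 = i ∧ q.1 = j then
        (Matrix.of fun k l => f i j (x k l) : Matrix (Fin m) (Fin m) ℂ) p.2 q.2 else 0) := by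
    ext p q
    simp only [Matrix.sum_apply, Matrix.of_apply, matPairing]
    rw [Finset.sum_eq_single p.1, Finset.sum_eq_single q.1] <;> simp +contextual [eq_comm]
  rw [e, Finset.sum_mul]
  refine (norm_sum_le _ _).trans (Finset.sum_le_sum fun i _ => ?_)
  rw [Finset.sum_mul]
  refine (norm_sum_le _ _).trans (Finset.sum_le_sum fun j _ => ?_)
  exact (l2_block_le _ i j).trans (norm_functional_le _ _)

lemma bddAbove_dualNormSet {n : ℕ} (f : Matrix (Fin n) (Fin n) (StrongDual ℂ X)) :
    BddAbove (dualNormSet f) := by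
  refine ⟨∑ i, ∑ j, ‖f i j‖, ?_⟩
  rintro r ⟨m, x, hx, rfl⟩
  refine (norm_matPairing_le_sum f x).trans ?_
  exact mul_le_of_le_one_right (by positivity) hx

lemma norm_matPairing_le_sSup {m n : ℕ} (f : Matrix (Fin n) (Fin n) (StrongDual ℂ X))
    (x : Matrix (Fin m) (Fin m) X) (hx : matNorm m x ≤ 1) :
    ‖matPairing f x‖ ≤ sSup (dualNormSet f) :=
  le_csSup (bddAbove_dualNormSet f) ⟨m, x, hx, rfl⟩

lemma sSup_dualNormSet_nonneg {n : ℕ} (f : Matrix (Fin n) (Fin n) (StrongDual ℂ X)) :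
    0 ≤ sSup (dualNormSet f) :=
  Real.sSup_nonneg (by rintro r ⟨m, x, hx, rfl⟩; exact norm_nonneg _)

lemma sSup_dualNormSet_le {n : ℕ} (f : Matrix (Fin n) (Fin n) (StrongDual ℂ X)) (C : ℝ)
    (hC : 0 ≤ C)
    (h : ∀ (m : ℕ) (x : Matrix (Fin m) (Fin m) X), matNorm m x ≤ 1 → ‖matPairing f x‖ ≤ C) :
    sSup (dualNormSet f) ≤ C :=
  Real.sSup_le (by rintro r ⟨m, x, hx, rfl⟩; exact h m x hx) hC

variable (X) in
/-- The norm of `M_n(X*) = CB(X, M_n)`: `‖[f_ij]‖` is the supremum of `‖[f_ij(x_kl)]‖` over all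
`m` and all `x` in the closed unit ball of `M_m(X)`. -/
def dualMatNorm (n : ℕ) : Seminorm ℂ (Matrix (Fin n) (Fin n) (StrongDual ℂ X)) :=
  Seminorm.ofSMulLE (𝕜 := ℂ) (fun f : Matrix (Fin n) (Fin n) (StrongDual ℂ X) => sSup (dualNormSet f))
    (by
      refine le_antisymm (sSup_dualNormSet_le _ _ le_rfl fun m x _ => ?_)
        (sSup_dualNormSet_nonneg _)
      have : matPairing (0 : Matrix (Fin n) (Fin n) (StrongDual ℂ X)) x = 0 := by
        ext p q; simp [matPairing]
      rw [this, norm_zero])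
    (fun f g => by
      refine sSup_dualNormSet_le _ _
        (add_nonneg (sSup_dualNormSet_nonneg _) (sSup_dualNormSet_nonneg _)) fun m x hx => ?_
      have : matPairing (f + g) x = matPairing f x + matPairing g x := by
        ext p q; simp [matPairing]
      rw [this]
      exact (norm_add_le _ _).trans
        (add_le_add (norm_matPairing_le_sSup f x hx) (norm_matPairing_le_sSup g x hx)))
    (fun c f => by
      refine sSup_dualNormSet_le _ _
        (mul_nonneg (norm_nonneg c) (sSup_dualNormSet_nonneg _)) fun m x hx => ?_
      have : matPairing (c • f) x = c • matPairing f x := by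
        ext p q; simp [matPairing]
      rw [this, norm_smul]
      exact mul_le_mul_of_nonneg_left (norm_matPairing_le_sSup f x hx) (norm_nonneg c))

/-- The dual operator space structure on `X*`. -/
instance instDual : OperatorSpace (StrongDual ℂ X) where
  matNorm n := dualMatNorm X n
  matNorm_one f := by
    change sSup (dualNormSet (Matrix.of fun (_ _ : Fin 1) => f)) = ‖f‖
    refine le_antisymm (sSup_dualNormSet_le _ _ (norm_nonneg _) fun m x hx => ?_) ?_
    · refine (norm_matPairing_le_sum _ x).trans ?_
      simpa using mul_le_of_le_one_right (norm_nonneg f) hx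
    · refine f.opNorm_le_of_unit_norm (sSup_dualNormSet_nonneg _) fun x hx => ?_
      have h := norm_matPairing_le_sSup (Matrix.of fun (_ _ : Fin 1) => f)
        (Matrix.of fun (_ _ : Fin 1) => x) (by rw [matNorm_one, hx])
      refine le_trans ?_ h
      have h2 := sq_le_l2 (matPairing (Matrix.of fun (_ _ : Fin 1) => f)
        (Matrix.of fun (_ _ : Fin 1) => x)) fun _ => 1
      simp only [Matrix.mulVec, dotProduct, matPairing, Matrix.of_apply, Finset.sum_const,
        Finset.card_univ, Fintype.card_prod, Fintype.card_fin, one_smul, mul_one, norm_one,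
        one_pow] at h2
      exact (sq_le_sq₀ (norm_nonneg _) (norm_nonneg _)).mp h2
  matNorm_directSum m n f g := by
    change sSup (dualNormSet (matBlocks f 0 0 g)) = max (sSup (dualNormSet f)) (sSup (dualNormSet g))
    refine le_antisymm ?_ (max_le ?_ ?_)
    · refine sSup_dualNormSet_le _ _ (le_max_of_le_left (sSup_dualNormSet_nonneg _))
        fun k x hx => ?_
      have hf := norm_matPairing_le_sSup f x hx
      have hg := norm_matPairing_le_sSup g x hx
      set C := max (sSup (dualNormSet f)) (sSup (dualNormSet g)) with hC
      have hf' : ‖matPairing f x‖ ≤ C := hf.trans (le_max_left _ _)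
      have hg' : ‖matPairing g x‖ ≤ C := hg.trans (le_max_right _ _)
      refine l2_le_of_sq _ _ ((norm_nonneg _).trans hf') fun v => ?_
      have h1 := sq_le_l2 (matPairing f x) fun p => v (Fin.castAdd n p.1, p.2)
      have h2 := sq_le_l2 (matPairing g x) fun p => v (Fin.natAdd m p.1, p.2)
      have e1 : ∀ p : Fin m × Fin k, (matPairing (matBlocks f 0 0 g) x).mulVec v
          (Fin.castAdd n p.1, p.2) =
          (matPairing f x).mulVec (fun p => v (Fin.castAdd n p.1, p.2)) p := by
        intro p
        simp [Matrix.mulVec, dotProduct, Fintype.sum_prod_type, Fin.sum_univ_add, matPairing,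
          matBlocks]
      have e2 : ∀ p : Fin n × Fin k, (matPairing (matBlocks f 0 0 g) x).mulVec v
          (Fin.natAdd m p.1, p.2) =
          (matPairing g x).mulVec (fun p => v (Fin.natAdd m p.1, p.2)) p := by
        intro p
        simp [Matrix.mulVec, dotProduct, Fintype.sum_prod_type, Fin.sum_univ_add, matPairing,
          matBlocks]
      simp only [← e1] at h1
      simp only [← e2] at h2
      rw [Fintype.sum_prod_type, Fintype.sum_prod_type] at h1 h2 ⊢
      rw [Fin.sum_univ_add, Fin.sum_univ_add, mul_add]
      refine add_le_add (h1.trans ?_) (h2.trans ?_) <;> gcongr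
    · refine sSup_dualNormSet_le _ _ (sSup_dualNormSet_nonneg _) fun k x hx => ?_
      refine le_trans ?_ (norm_matPairing_le_sSup (matBlocks f 0 0 g) x hx)
      have : matPairing f x = (matPairing (matBlocks f 0 0 g) x).submatrix
          (fun p => (Fin.castAdd n p.1, p.2)) (fun p => (Fin.castAdd n p.1, p.2)) := by
        ext p q; simp [matPairing, matBlocks]
      rw [this]
      refine l2_submatrix_le _ _ _ ?_ ?_ <;>
      · rintro ⟨a, b⟩ ⟨c, d⟩ h
        simpa using h
    · refine sSup_dualNormSet_le _ _ (sSup_dualNormSet_nonneg _) fun k x hx => ?_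
      refine le_trans ?_ (norm_matPairing_le_sSup (matBlocks f 0 0 g) x hx)
      have : matPairing g x = (matPairing (matBlocks f 0 0 g) x).submatrix
          (fun p => (Fin.natAdd m p.1, p.2)) (fun p => (Fin.natAdd m p.1, p.2)) := by
        ext p q; simp [matPairing, matBlocks]
      rw [this]
      refine l2_submatrix_le _ _ _ ?_ ?_ <;>
      · rintro ⟨a, b⟩ ⟨c, d⟩ h
        simpa using h
  matNorm_sandwich_le m n α f β := by
    change sSup (dualNormSet (matSandwich α f β)) ≤ ‖α‖ * sSup (dualNormSet f) * ‖β‖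
    have hf0 := sSup_dualNormSet_nonneg f
    refine sSup_dualNormSet_le _ _ (by positivity) fun k x hx => ?_
    have e : matPairing (matSandwich α f β) x =
        (Matrix.of fun (p : Fin n × Fin k) (q : Fin m × Fin k) =>
          if p.2 = q.2 then α p.1 q.1 else 0) * matPairing f x *
        (Matrix.of fun (p : Fin m × Fin k) (q : Fin n × Fin k) =>
          if p.2 = q.2 then β p.1 q.1 else 0) := by
      ext p q
      simp only [matPairing, matSandwich, Matrix.of_apply, Matrix.mul_apply,
        Fintype.sum_prod_type, sum_apply, smul_apply,
        smul_eq_mul, ite_mul, zero_mul, mul_ite, mul_zero, Finset.sum_ite_eq, Finset.sum_ite_eq',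
        Finset.mem_univ, if_true, Finset.sum_mul]
      rw [Finset.sum_comm]
      refine Finset.sum_congr rfl fun i _ => Finset.sum_congr rfl fun j _ => ?_
      ring
    rw [e]
    refine (Matrix.l2_opNorm_mul _ _).trans ?_
    refine mul_le_mul ((Matrix.l2_opNorm_mul _ _).trans ?_) (l2_kron_one_le β) (norm_nonneg _)
      (by positivity)
    exact mul_le_mul (l2_kron_one_le α) (norm_matPairing_le_sSup f x hx) (norm_nonneg _)
      (norm_nonneg _)

/-- The norm of the column `[x; y]` in `C_2(M_n(X)) = M_{2n,n}(X)`. As for every rectangular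
matrix, it is the norm of the square matrix obtained by adding zero columns. -/
def colNorm {n : ℕ} (x y : Matrix (Fin n) (Fin n) X) : ℝ :=
  matNorm (n + n) (matBlocks x 0 y 0)

/-- The norm of `(v 0, v 1)` in `M_p(R_2) = M_{p,2p}(ℂ)`. -/
def rowScalarNorm {p : ℕ} (v : Fin 2 → Matrix (Fin p) (Fin p) ℂ) : ℝ :=
  ‖(Matrix.of fun i (kj : Fin 2 × Fin p) => v kj.1 i kj.2 : Matrix (Fin p) (Fin 2 × Fin p) ℂ)‖

/-- The norm of `[x y]` in `M_n(R_2[X])`, where `R_2[X]` is the operator space projective tensor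
product of `R_2` and `X`, the row `[x y]` being identified with `e_0 ⊗ x + e_1 ⊗ y`. The norm of
`u` is the infimum of `‖α‖ ‖v‖ ‖w‖ ‖β‖` over all representations `u = α (v ⊗ w) β` with
`v ∈ M_p(R_2)`, `w ∈ M_q(X)` and scalar matrices `α ∈ M_{n,pq}`, `β ∈ M_{pq,n}`. -/
def rowProjNorm {n : ℕ} (x y : Matrix (Fin n) (Fin n) X) : ℝ :=
  sInf {r | ∃ (p q : ℕ) (α : Matrix (Fin n) (Fin p × Fin q) ℂ)
    (v : Fin 2 → Matrix (Fin p) (Fin p) ℂ) (w : Matrix (Fin q) (Fin q) X)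
    (β : Matrix (Fin p × Fin q) (Fin n) ℂ),
    x = matSandwich α (Matrix.of fun a b => v 0 a.1 b.1 • w a.2 b.2) β ∧
    y = matSandwich α (Matrix.of fun a b => v 1 a.1 b.1 • w a.2 b.2) β ∧
    r = ‖α‖ * rowScalarNorm v * matNorm q w * ‖β‖}

/-- `P` is a projection and each `P_n` is a left `M`-projection of `M_n(X)`:
`‖x‖ = ‖[P_n x; x - P_n x]‖` in `C_2(M_n(X))`. -/
def IsCompleteLeftMProjection (P : X →ₗ[ℂ] X) : Prop :=
  P ∘ₗ P = P ∧ ∀ (n : ℕ) (x : Matrix (Fin n) (Fin n) X),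
    matNorm n x = colNorm (x.map P) (x - x.map P)

/-- `P` is a projection and `x ↦ [P x, x - P x]`, `X → R_2[X]`, is a complete isometry. -/
def IsCompleteRightLProjection (P : X →ₗ[ℂ] X) : Prop :=
  P ∘ₗ P = P ∧ ∀ (n : ℕ) (x : Matrix (Fin n) (Fin n) X),
    matNorm n x = rowProjNorm (x.map P) (x - x.map P)

/-- The range of a complete left `M`-projection. -/
def IsCompleteRightMSummand (J : Submodule ℂ X) : Prop :=
  ∃ P : X →ₗ[ℂ] X, IsCompleteLeftMProjection P ∧ LinearMap.range P = J

/-- The range of a complete right `L`-projection. -/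
def IsCompleteLeftLSummand (J : Submodule ℂ X) : Prop :=
  ∃ P : X →ₗ[ℂ] X, IsCompleteRightLProjection P ∧ LinearMap.range P = J

/-- A closed subspace `J` whose second annihilator in `X**` is a complete right `M`-summand. -/
def IsCompleteRightMIdeal (J : Submodule ℂ X) : Prop :=
  IsClosed (J : Set X) ∧ IsCompleteRightMSummand (X := StrongDual ℂ (StrongDual ℂ X))
    (StrongDual.polarSubmodule ℂ (StrongDual.polarSubmodule ℂ J))

/-- A linear idempotent of norm at most one. -/
def IsContractiveProjection {E : Type*} [NormedAddCommGroup E] [NormedSpace ℂ E]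
    (Q : E →ₗ[ℂ] E) : Prop :=
  Q ∘ₗ Q = Q ∧ ∀ x, ‖Q x‖ ≤ ‖x‖

/-- All amplifications of `e` preserve the matrix norms. -/
def IsCompleteIsometry {E F : Type*} [NormedAddCommGroup E] [NormedSpace ℂ E] [OperatorSpace E]
    [NormedAddCommGroup F] [NormedSpace ℂ F] [OperatorSpace F] (e : E →ₗ[ℂ] F) : Prop :=
  ∀ (n : ℕ) (x : Matrix (Fin n) (Fin n) E), matNorm n (x.map e) = matNorm n x

end OperatorSpace

end

/-! ### Columns, one-sided `M`-projections, and uniqueness -/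

noncomputable section
namespace OperatorSpace

/-! The engine is a one-sided Pythagorean inequality. A column `[x; y]` over an operator space has
norm at most `√(‖x‖² + ‖y‖²)`, so a complete left `M`-projection `P` satisfies `‖Pu + (v - Pv)‖² ≤
‖Pu‖² + ‖v - Pv‖²`. Let `Q` be a contractive projection with the same range, `x = v - Pv` and `y =
Qx`. Applying `Q` to `ty + x` gives `(t+1)²‖y‖² ≤ t²‖y‖² + ‖x‖²` for all `t ≥ 0`, hence `y = 0` and
`Qv = QPv = Pv`. This is (a), in `eq_of_range_eq_of_sq_le`.

For (b), pass to adjoints: equal kernels become equal ranges, and the pairing of rows `R_2[X]` with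
columns `C_2(X*)` shows that the adjoint of a right `L`-projection satisfies the same inequality.

For (c), the second adjoint of a contractive projection `Q` onto `J` is a contractive projection
onto `J^⊥⊥`, so by (a) it is the given projection `P` of `X**`. Since `X → X**` is a complete
isometry, `Q` inherits the `M`-projection identity.

For (d), let `J = Z*`. Extend each `z ∈ Z` from a functional on `J` to one on `X`. Elements of
`J^⊥⊥` do not see the choice of extension, so `P` induces a contraction `X → Z* = J` fixing `J`, and
(c) applies.

For (e), let `X = Y*`. Compressing `P` by `X → X**` and the restriction `X** → X` gives a
contractive projection `Q` onto `J`, so `P = Q**`. The Pythagorean argument, used once more, shows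
that `P` preserves the kernel of the restriction, which is `Y^⊥`. Thus `Q*` maps `Y` into `Y` and
`Q` is the adjoint of some `R`. Then `J` is the annihilator of `ker R`, the range of `1 - R`.

That `1 - R` is a right `L`-projection, and that `X → X**` is a complete isometry, both need
functionals that norm matrices. These come from a matrix version of Hahn–Banach separation,
`IsMatrixConvex.exists_matEval_separating`, applied to the unit balls of `X` and of `R_2[X]`. -/

/-- Two projections with the same range agree if one of them is contractive and the other one is
a one-sided `M`-projection at the level of norms. -/
lemma eq_of_range_eq_of_sq_le {E : Type*} [NormedAddCommGroup E] [NormedSpace ℂ E]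
    {P Q : E →ₗ[ℂ] E} (hP : P ∘ₗ P = P)
    (hsq : ∀ u v : E, ‖P u + (v - P v)‖ ^ 2 ≤ ‖P u‖ ^ 2 + ‖v - P v‖ ^ 2)
    (hQ : IsContractiveProjection Q) (h : LinearMap.range Q = LinearMap.range P) : P = Q := by
  have hPP : ∀ x, P (P x) = P x := fun x => LinearMap.congr_fun hP x
  have hQQ : ∀ x, Q (Q x) = Q x := fun x => LinearMap.congr_fun hQ.1 x
  have hQP : ∀ x, Q (P x) = P x := fun x => by
    obtain ⟨z, hz⟩ : P x ∈ LinearMap.range Q := h ▸ ⟨x, rfl⟩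
    rw [← hz, hQQ]
  have hPQ : ∀ x, P (Q x) = Q x := fun x => by
    obtain ⟨z, hz⟩ : Q x ∈ LinearMap.range P := h ▸ ⟨x, rfl⟩
    rw [← hz, hPP]
  ext v
  set x := v - P v with hx
  set y := Q x with hy
  have key : ∀ t : ℝ, 0 ≤ t → (t + 1) ^ 2 * ‖y‖ ^ 2 ≤ t ^ 2 * ‖y‖ ^ 2 + ‖x‖ ^ 2 := fun t ht => by
    have h1 := hsq ((t : ℂ) • y) v
    have h2 : P ((t : ℂ) • y) = (t : ℂ) • y := by rw [map_smul, hy, hPQ]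
    rw [h2, ← hx, norm_smul, Complex.norm_real, Real.norm_of_nonneg ht, mul_pow] at h1
    have h3 := hQ.2 ((t : ℂ) • y + x)
    have h4 : Q ((t : ℂ) • y + x) = ((t + 1 : ℝ) : ℂ) • y := by
      rw [map_add, map_smul, ← hy, hy, hQQ, Complex.ofReal_add, add_smul, Complex.ofReal_one,
        one_smul]
    rw [h4, norm_smul, Complex.norm_real, Real.norm_of_nonneg (by positivity)] at h3
    calc _ = ((t + 1) * ‖y‖) ^ 2 := by ring
      _ ≤ ‖(t : ℂ) • y + x‖ ^ 2 := by gcongr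
      _ ≤ _ := h1
  have hy0 : y = 0 := by
    by_contra hne
    have hpos : 0 < ‖y‖ ^ 2 := by positivity
    -- `key` says `(2t + 1)‖y‖² ≤ ‖x‖²`; this `t` makes the left side `2‖x‖² + ‖y‖²`.
    have := key (‖x‖ ^ 2 / ‖y‖ ^ 2) (by positivity)
    have e : ‖x‖ ^ 2 / ‖y‖ ^ 2 * ‖y‖ ^ 2 = ‖x‖ ^ 2 := by field_simp
    nlinarith [sq_nonneg ‖x‖]
  have : Q v - Q (P v) = 0 := by rw [← map_sub, ← hx, ← hy, hy0]
  rw [hQP] at this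
  exact (sub_eq_zero.mp this).symm

section ScalarMatrices

variable {a b c d : Type*} [Fintype a] [Fintype b] [Fintype c] [Fintype d]
  [DecidableEq a] [DecidableEq b] [DecidableEq c] [DecidableEq d]

lemma l2_one_le : ‖(1 : Matrix a a ℂ)‖ ≤ 1 :=
  l2_le_of_sq _ _ zero_le_one fun v => by simp

lemma l2_one_submatrix_le (e : b → a) (e' : c → a) (he : Function.Injective e)
    (he' : Function.Injective e') : ‖(1 : Matrix a a ℂ).submatrix e e'‖ ≤ 1 :=
  (l2_submatrix_le _ e e' he he').trans l2_one_le

lemma l2_reindex (e : a ≃ c) (e' : b ≃ d) (A : Matrix a b ℂ) :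
    ‖Matrix.reindex e e' A‖ = ‖A‖ := by
  refine le_antisymm (l2_submatrix_le _ _ _ e.symm.injective e'.symm.injective) ?_
  have h := l2_submatrix_le (Matrix.reindex e e' A) e e' e.injective e'.injective
  rwa [Matrix.reindex_apply, Matrix.submatrix_submatrix, Equiv.symm_comp_self,
    Equiv.symm_comp_self, Matrix.submatrix_id_id] at h

end ScalarMatrices

section Blocks

variable {V : Type*} {m n : ℕ} (x : Matrix (Fin m) (Fin m) V) (y : Matrix (Fin m) (Fin n) V)
  (z : Matrix (Fin n) (Fin m) V) (w : Matrix (Fin n) (Fin n) V)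

lemma matBlocks_castAdd_castAdd (i j : Fin m) :
    matBlocks x y z w (Fin.castAdd n i) (Fin.castAdd n j) = x i j := by simp [matBlocks]

lemma matBlocks_castAdd_natAdd (i : Fin m) (j : Fin n) :
    matBlocks x y z w (Fin.castAdd n i) (Fin.natAdd m j) = y i j := by simp [matBlocks]

lemma matBlocks_natAdd_castAdd (i : Fin n) (j : Fin m) :
    matBlocks x y z w (Fin.natAdd m i) (Fin.castAdd n j) = z i j := by simp [matBlocks]

lemma matBlocks_natAdd_natAdd (i j : Fin n) :
    matBlocks x y z w (Fin.natAdd m i) (Fin.natAdd m j) = w i j := by simp [matBlocks]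

end Blocks

section Sandwich

variable {V : Type*} [AddCommGroup V] [Module ℂ V]
  {a b c d : Type*} [Fintype b] [Fintype c]

lemma matSandwich_one_submatrix [DecidableEq b] [DecidableEq c] (e : a → b) (e' : d → c)
    (x : Matrix b c V) :
    matSandwich ((1 : Matrix b b ℂ).submatrix e id) x ((1 : Matrix c c ℂ).submatrix id e') =
      x.submatrix e e' := by
  ext i j
  simp only [matSandwich, Matrix.of_apply, Matrix.submatrix_apply]
  rw [Finset.sum_eq_single (e i), Finset.sum_eq_single (e' j)] <;>
    simp +contextual [Matrix.one_apply, eq_comm]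

end Sandwich

variable {X : Type*} [NormedAddCommGroup X] [NormedSpace ℂ X] [OperatorSpace X]

lemma matNorm_sandwich_le_of_le {m n : ℕ} {α : Matrix (Fin n) (Fin m) ℂ}
    (x : Matrix (Fin m) (Fin m) X) {β : Matrix (Fin m) (Fin n) ℂ} (hα : ‖α‖ ≤ 1) (hβ : ‖β‖ ≤ 1) :
    matNorm n (matSandwich α x β) ≤ matNorm m x := by
  have h0 := apply_nonneg (matNorm (X := X) m) x
  calc _ ≤ ‖α‖ * matNorm m x * ‖β‖ := matNorm_sandwich_le _ _ _ _ _
    _ ≤ 1 * matNorm m x * 1 := by gcongr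
    _ = _ := by ring

lemma matNorm_submatrix_le {m n : ℕ} (x : Matrix (Fin m) (Fin m) X) {e e' : Fin n → Fin m}
    (he : Function.Injective e) (he' : Function.Injective e') :
    matNorm n (x.submatrix e e') ≤ matNorm m x := by
  rw [← matSandwich_one_submatrix]
  exact matNorm_sandwich_le_of_le x (l2_one_submatrix_le _ _ he Function.injective_id)
    (l2_one_submatrix_le _ _ Function.injective_id he')

/-- The norm of a column of two vectors is at most the `ℓ²`-sum of their norms. -/
lemma colNorm_one_sq_le (x y : X) :
    colNorm (Matrix.of fun (_ _ : Fin 1) => x) (Matrix.of fun (_ _ : Fin 1) => y) ^ 2 ≤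
      ‖x‖ ^ 2 + ‖y‖ ^ 2 := by
  -- Factor `[x; y] = diag(x/s, y/t) [s; t]`: the diagonal is a contraction and the scalar column
  -- has norm `√(s² + t²)`. Strictly positive `s`, `t` allow `x` or `y` to vanish; they tend to the
  -- norms at the end.
  have main : ∀ s t : ℝ, ‖x‖ ≤ s → ‖y‖ ≤ t → 0 < s → 0 < t →
      colNorm (Matrix.of fun (_ _ : Fin 1) => x) (Matrix.of fun (_ _ : Fin 1) => y) ^ 2 ≤
        s ^ 2 + t ^ 2 := by
    intro s t hs ht hs0 ht0
    set β : Matrix (Fin (1 + 1)) (Fin (1 + 1)) ℂ :=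
      matBlocks (Matrix.of fun _ _ => (s : ℂ)) 0 (Matrix.of fun _ _ => (t : ℂ)) 0 with hβ
    have hβn : ‖β‖ ≤ Real.sqrt (s ^ 2 + t ^ 2) := by
      refine l2_le_of_sq _ _ (Real.sqrt_nonneg _) fun v => ?_
      rw [Real.sq_sqrt (by positivity)]
      simp only [Matrix.mulVec, dotProduct, hβ, Matrix.of_apply, Fin.sum_univ_add,
        Finset.univ_unique, Finset.sum_singleton, matBlocks_castAdd_castAdd,
        matBlocks_castAdd_natAdd, matBlocks_natAdd_castAdd, matBlocks_natAdd_natAdd,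
        Matrix.zero_apply, zero_mul, add_zero, norm_mul, Complex.norm_real, mul_pow,
        Real.norm_eq_abs, sq_abs]
      rw [← add_mul]
      gcongr
      exact le_add_of_nonneg_right (by positivity)
    have h1 : matNorm 1 (Matrix.of fun (_ _ : Fin 1) => ((s⁻¹ : ℝ) : ℂ) • x) ≤ 1 := by
      rw [matNorm_one, norm_smul, Complex.norm_real, Real.norm_of_nonneg (by positivity)]
      exact inv_mul_le_one_of_le₀ hs hs0.le
    have h2 : matNorm 1 (Matrix.of fun (_ _ : Fin 1) => ((t⁻¹ : ℝ) : ℂ) • y) ≤ 1 := by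
      rw [matNorm_one, norm_smul, Complex.norm_real, Real.norm_of_nonneg (by positivity)]
      exact inv_mul_le_one_of_le₀ ht ht0.le
    have h := matNorm_sandwich_le (1 + 1) (1 + 1) 1 (matBlocks
      (Matrix.of fun (_ _ : Fin 1) => ((s⁻¹ : ℝ) : ℂ) • x) 0 0
      (Matrix.of fun (_ _ : Fin 1) => ((t⁻¹ : ℝ) : ℂ) • y)) β
    rw [matNorm_directSum] at h
    have e : matSandwich 1 (matBlocks
        (Matrix.of fun (_ _ : Fin 1) => ((s⁻¹ : ℝ) : ℂ) • x) 0 0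
        (Matrix.of fun (_ _ : Fin 1) => ((t⁻¹ : ℝ) : ℂ) • y)) β =
        matBlocks (Matrix.of fun (_ _ : Fin 1) => x) 0 (Matrix.of fun (_ _ : Fin 1) => y) 0 := by
      ext i j
      simp only [matSandwich, Matrix.of_apply, Matrix.one_apply, ite_mul, one_mul, zero_mul,
        ite_smul, zero_smul, Finset.sum_ite_irrel, Finset.sum_const_zero, Finset.sum_ite_eq,
        Finset.mem_univ, if_true]
      rw [Fin.sum_univ_add]
      refine Fin.addCases (fun i => ?_) (fun i => ?_) i <;>
        refine Fin.addCases (fun j => ?_) (fun j => ?_) j <;>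
        simp only [matBlocks_castAdd_castAdd, matBlocks_castAdd_natAdd, matBlocks_natAdd_castAdd,
          matBlocks_natAdd_natAdd, hβ, Matrix.of_apply, Matrix.zero_apply, zero_mul, zero_smul, smul_zero,
          Finset.univ_unique, Finset.sum_singleton, add_zero, zero_add, smul_smul,
          ← Complex.ofReal_mul, mul_inv_cancel₀ hs0.ne', mul_inv_cancel₀ ht0.ne',
          Complex.ofReal_one, one_smul]
    rw [e] at h
    have h0 : colNorm (Matrix.of fun (_ _ : Fin 1) => x) (Matrix.of fun (_ _ : Fin 1) => y) ≤
        Real.sqrt (s ^ 2 + t ^ 2) := by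
      refine h.trans ?_
      calc _ ≤ 1 * 1 * Real.sqrt (s ^ 2 + t ^ 2) := by
            gcongr
            · exact l2_one_le
            · exact max_le h1 h2
        _ = _ := by ring
    calc _ ≤ Real.sqrt (s ^ 2 + t ^ 2) ^ 2 := by
          gcongr
          exact apply_nonneg (matNorm (X := X) _) _
      _ = _ := Real.sq_sqrt (by positivity)
  have lim : Filter.Tendsto (fun δ : ℝ => (‖x‖ + δ) ^ 2 + (‖y‖ + δ) ^ 2)
      (nhdsWithin 0 (Set.Ioi 0)) (nhds ((‖x‖ + 0) ^ 2 + (‖y‖ + 0) ^ 2)) :=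
    (Continuous.tendsto (by fun_prop) 0).mono_left nhdsWithin_le_nhds
  simp only [add_zero] at lim
  refine ge_of_tendsto lim ?_
  filter_upwards [self_mem_nhdsWithin] with δ hδ
  have hδ : 0 < δ := hδ
  exact main _ _ (by linarith) (by linarith) (by positivity) (by positivity)

/-- `P` sends `Pu + (v - Pv)` to `Pu`, so the case `n = 1` of the definition computes its norm as
that of the column `[Pu; v - Pv]`. -/
lemma IsCompleteLeftMProjection.sq_le {P : X →ₗ[ℂ] X} (hP : IsCompleteLeftMProjection P)
    (u v : X) : ‖P u + (v - P v)‖ ^ 2 ≤ ‖P u‖ ^ 2 + ‖v - P v‖ ^ 2 := by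
  have hPP : ∀ x, P (P x) = P x := fun x => LinearMap.congr_fun hP.1 x
  have h := hP.2 1 (Matrix.of fun _ _ => P u + (v - P v))
  rw [matNorm_one] at h
  have e1 : (Matrix.of fun (_ _ : Fin 1) => P u + (v - P v)).map P =
      Matrix.of fun _ _ => P u := by ext; simp [hPP]
  have e2 : (Matrix.of fun (_ _ : Fin 1) => P u + (v - P v)) -
      (Matrix.of fun (_ _ : Fin 1) => P u) = Matrix.of fun _ _ => v - P v := by ext; simp
  rw [e1, e2] at h
  rw [h]
  exact colNorm_one_sq_le _ _

lemma IsCompleteLeftMProjection.eq_of_range_eq {P Q : X →ₗ[ℂ] X}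
    (hP : IsCompleteLeftMProjection P) (hQ : IsContractiveProjection Q)
    (h : LinearMap.range Q = LinearMap.range P) : P = Q :=
  eq_of_range_eq_of_sq_le hP.1 hP.sq_le hQ h

end OperatorSpace
end

/-! ### Trace densities on `M_n` and the algebra of `α x β` -/

noncomputable section
namespace OperatorSpace

section Density

lemma re_trace_conjTranspose_mul_self {m n : Type*} [Fintype m] [Fintype n] (A : Matrix m n ℂ) :
    (A.conjTranspose * A).trace.re = ∑ i, ∑ k, ‖A i k‖ ^ 2 := by
  rw [Finset.sum_comm]
  simp only [Matrix.trace, Matrix.diag, Matrix.mul_apply, Matrix.conjTranspose_apply,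
    Complex.re_sum]
  refine Finset.sum_congr rfl fun k _ => Finset.sum_congr rfl fun i _ => ?_
  rw [Complex.star_def, Complex.conj_mul', ← Complex.ofReal_pow, Complex.ofReal_re]

variable {n : ℕ}

/-- A real functional on `M_n` is represented on hermitian matrices by a hermitian density. -/
lemma exists_isHermitian_trace (p : Matrix (Fin n) (Fin n) ℂ →ₗ[ℝ] ℝ) :
    ∃ ρ : Matrix (Fin n) (Fin n) ℂ, ρ.IsHermitian ∧
      ∀ A : Matrix (Fin n) (Fin n) ℂ, A.IsHermitian → (ρ * A).trace.re = p A := by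
  set pc : Matrix (Fin n) (Fin n) ℂ →ₗ[ℂ] ℂ := Module.Dual.extendRCLike (𝕜 := ℂ) p with hpc
  set σ : Matrix (Fin n) (Fin n) ℂ := Matrix.of fun j i => pc (Matrix.single i j 1) with hσ
  have hσt : ∀ A : Matrix (Fin n) (Fin n) ℂ, (σ * A).trace = pc A := fun A => by
    conv_rhs => rw [Matrix.matrix_eq_sum_single A]
    simp only [map_sum, Matrix.trace, Matrix.diag, Matrix.mul_apply, hσ, Matrix.of_apply]
    rw [Finset.sum_comm]
    refine Finset.sum_congr rfl fun i _ => Finset.sum_congr rfl fun j _ => ?_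
    have : Matrix.single i j (A i j) = A i j • Matrix.single i j (1 : ℂ) := by simp
    rw [this, map_smul, smul_eq_mul, mul_comm]
  have hre : ∀ A : Matrix (Fin n) (Fin n) ℂ, (σ * A).trace.re = p A := fun A => by
    rw [hσt]
    exact Module.Dual.re_extendRCLike_apply (𝕜 := ℂ) p A
  -- The density `σ` of the complexified functional need not be hermitian, but its hermitian part
  -- has the same real trace against hermitian `A`.
  refine ⟨(1 / 2 : ℝ) • (σ + σ.conjTranspose), ?_, fun A hA => ?_⟩
  · simp [Matrix.IsHermitian, add_comm]
  · have h2 : (σ.conjTranspose * A).trace.re = p A := by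
      have : σ.conjTranspose * A = (A * σ).conjTranspose := by
        rw [Matrix.conjTranspose_mul, hA.eq]
      rw [this, Matrix.trace_conjTranspose, Matrix.trace_mul_comm, Complex.star_def,
        Complex.conj_re, hre]
    rw [Matrix.smul_mul, add_mul, Matrix.trace_smul, Complex.smul_re, Matrix.trace_add,
      Complex.add_re, hre, h2, smul_eq_mul]
    ring

open scoped MatrixOrder ComplexOrder in
/-- A positive functional of norm at most one on `M_n` is dominated by `αα* ↦ ‖Bα‖²`
(Hilbert–Schmidt norm) for an invertible `B` of Hilbert–Schmidt norm close to one. -/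
lemma exists_isUnit_dominating (p : Matrix (Fin n) (Fin n) ℂ →ₗ[ℝ] ℝ)
    (h0 : ∀ α : Matrix (Fin n) (Fin 1) ℂ, 0 ≤ p (α * α.conjTranspose)) (h1 : p 1 ≤ 1)
    {ε : ℝ} (hε : 0 < ε) :
    ∃ B : Matrix (Fin n) (Fin n) ℂ, IsUnit B ∧ ∑ i, ∑ j, ‖B i j‖ ^ 2 ≤ 1 + ε ∧
      ∀ (m : ℕ) (α : Matrix (Fin n) (Fin m) ℂ),
        p (α * α.conjTranspose) ≤ ∑ i, ∑ k, ‖(B * α) i k‖ ^ 2 := by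
  obtain ⟨ρ, hρ, hp⟩ := exists_isHermitian_trace p
  have hpos : ρ.PosSemidef := by
    refine Matrix.PosSemidef.of_dotProduct_mulVec_nonneg hρ fun x => ?_
    rw [Complex.nonneg_iff]
    refine ⟨?_, (hρ.im_star_dotProduct_mulVec_self x).symm⟩
    have := h0 (Matrix.of fun i _ => x i)
    rw [← hp _ (Matrix.isHermitian_mul_conjTranspose_self _)] at this
    convert this using 2
    simp only [dotProduct, Matrix.mulVec, Matrix.trace, Matrix.diag, Matrix.mul_apply,
      Matrix.conjTranspose_apply, Matrix.of_apply, Finset.univ_unique, Finset.sum_singleton,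
      Pi.star_apply, Finset.mul_sum]
    refine Finset.sum_congr rfl fun i _ => Finset.sum_congr rfl fun j _ => ?_
    ring
  -- The density is only positive semidefinite; adding `δ · 1` gives an invertible `B` with `B*B = ρ
  -- + δ · 1`. Its squared Hilbert–Schmidt norm is `p 1 + δ n`, and `δ n ≤ ε`, also when `n = 0`.
  set δ : ℝ := ε / (n + 1) with hδ
  have hδ0 : 0 < δ := by positivity
  have hpd : (ρ + δ • (1 : Matrix (Fin n) (Fin n) ℂ)).PosDef :=
    Matrix.PosDef.posSemidef_add hpos (Matrix.PosDef.one.smul hδ0)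
  obtain ⟨B, hB, hBρ⟩ := CStarAlgebra.isStrictlyPositive_iff_eq_star_mul_self.mp
    hpd.isStrictlyPositive
  have key : ∀ (m : Type) [Fintype m] (α : Matrix (Fin n) m ℂ),
      ∑ i, ∑ k, ‖(B * α) i k‖ ^ 2 =
        p (α * α.conjTranspose) + δ * ∑ i, ∑ k, ‖α i k‖ ^ 2 := by
    intro m _ α
    have e : (B * α).conjTranspose * (B * α) = α.conjTranspose * (ρ * α) +
        δ • (α.conjTranspose * α) := by
      rw [Matrix.conjTranspose_mul, Matrix.mul_assoc, ← Matrix.mul_assoc B.conjTranspose,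
        ← Matrix.star_eq_conjTranspose B, ← hBρ, Matrix.add_mul, Matrix.mul_add, Matrix.smul_mul,
        Matrix.one_mul, Matrix.mul_smul]
    rw [← re_trace_conjTranspose_mul_self, ← re_trace_conjTranspose_mul_self,
      ← hp _ (Matrix.isHermitian_mul_conjTranspose_self _), e, Matrix.trace_add, Complex.add_re,
      Matrix.trace_smul, Complex.smul_re, smul_eq_mul, Matrix.trace_mul_comm, Matrix.mul_assoc]
  refine ⟨B, hB, ?_, fun m α => ?_⟩
  · have h := key (Fin n) 1
    rw [Matrix.mul_one, Matrix.conjTranspose_one, Matrix.mul_one] at h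
    have h2 : ∑ i : Fin n, ∑ k : Fin n, ‖(1 : Matrix (Fin n) (Fin n) ℂ) i k‖ ^ 2 = n := by
      have : ∀ i : Fin n, ∑ k : Fin n, ‖(1 : Matrix (Fin n) (Fin n) ℂ) i k‖ ^ 2 = 1 := fun i => by
        rw [Finset.sum_eq_single i] <;> simp +contextual [eq_comm]
      simp [this]
    rw [h, h2]
    have h3 : δ * n ≤ ε := by
      rw [hδ, div_mul_eq_mul_div, div_le_iff₀ (by positivity)]
      nlinarith
    linarith
  · rw [key (Fin m) α]
    have : 0 ≤ δ * ∑ i, ∑ k, ‖α i k‖ ^ 2 := by positivity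
    linarith

end Density

section Separation

variable {V : Type*} [AddCommGroup V] [Module ℂ V]

lemma matSandwich_matSandwich {a b c d e g : Type*} [Fintype b] [Fintype c] [Fintype d]
    [Fintype e] (α : Matrix a b ℂ) (α' : Matrix b c ℂ) (x : Matrix c d V) (β' : Matrix d e ℂ)
    (β : Matrix e g ℂ) :
    matSandwich α (matSandwich α' x β') β = matSandwich (α * α') x (β' * β) := by
  ext i j
  simp only [matSandwich, Matrix.of_apply, Matrix.mul_apply, Finset.smul_sum, smul_smul,
    Finset.sum_mul_sum, Finset.sum_smul]
  simp only [← Finset.sum_product', Finset.univ_product_univ]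
  refine Finset.sum_nbij' (fun p => (p.2.2.1, p.2.2.2, p.1, p.2.1))
    (fun p => (p.2.2.1, p.2.2.2, p.1, p.2.1)) (by simp) (by simp) (by simp) (by simp)
    fun p _ => ?_
  congr 1
  ring

/-- The map `x ↦ α x β` on matrices over a vector space. -/
def matSandwichLinear {a b c d : Type*} [Fintype b] [Fintype c] (α : Matrix a b ℂ)
    (β : Matrix c d ℂ) : Matrix b c V →ₗ[ℂ] Matrix a d V where
  toFun x := matSandwich α x β
  map_add' x y := by
    ext i j; simp [matSandwich, Finset.sum_add_distrib]
  map_smul' r x := by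
    ext i j
    simp only [matSandwich, Matrix.of_apply, Matrix.smul_apply, RingHom.id_apply,
      Finset.smul_sum]
    refine Finset.sum_congr rfl fun k _ => Finset.sum_congr rfl fun l _ => ?_
    rw [smul_comm]

lemma matSandwich_smul_smul {a b c d : Type*} [Fintype b] [Fintype c] (s t : ℂ)
    (α : Matrix a b ℂ) (x : Matrix b c V) (β : Matrix c d ℂ) :
    matSandwich (s • α) x (t • β) = (s * t) • matSandwich α x β := by
  ext i j
  simp only [matSandwich, Matrix.of_apply, Matrix.smul_apply, Finset.smul_sum, smul_smul,
    smul_eq_mul]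
  refine Finset.sum_congr rfl fun k _ => Finset.sum_congr rfl fun l _ => ?_
  congr 1
  ring

lemma matSandwich_zero_left {a b c d : Type*} [Fintype b] [Fintype c]
    (x : Matrix b c V) (β : Matrix c d ℂ) : matSandwich (0 : Matrix a b ℂ) x β = 0 := by
  ext i j; simp [matSandwich]

/-- The row `[α α']`. -/
def rowAppend {n m m' : ℕ} (α : Matrix (Fin n) (Fin m) ℂ) (α' : Matrix (Fin n) (Fin m') ℂ) :
    Matrix (Fin n) (Fin (m + m')) ℂ :=
  Matrix.of fun i j => Fin.addCases (α i) (α' i) j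

/-- The column `[β; β']`. -/
def colAppend {n m m' : ℕ} (β : Matrix (Fin m) (Fin n) ℂ) (β' : Matrix (Fin m') (Fin n) ℂ) :
    Matrix (Fin (m + m')) (Fin n) ℂ :=
  Matrix.of fun i j => Fin.addCases (fun i => β i j) (fun i => β' i j) i

section Append

variable {n m m' : ℕ} (α : Matrix (Fin n) (Fin m) ℂ) (α' : Matrix (Fin n) (Fin m') ℂ)
  (β : Matrix (Fin m) (Fin n) ℂ) (β' : Matrix (Fin m') (Fin n) ℂ)

lemma matSandwich_append (x : Matrix (Fin m) (Fin m) V) (x' : Matrix (Fin m') (Fin m') V) :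
    matSandwich (rowAppend α α') (matBlocks x 0 0 x') (colAppend β β') =
      matSandwich α x β + matSandwich α' x' β' := by
  ext i j
  simp only [matSandwich, rowAppend, colAppend, Matrix.of_apply, Matrix.add_apply,
    Fin.sum_univ_add, Fin.addCases_left, Fin.addCases_right, matBlocks_castAdd_castAdd,
    matBlocks_castAdd_natAdd, matBlocks_natAdd_castAdd, matBlocks_natAdd_natAdd,
    Matrix.zero_apply, smul_zero, Finset.sum_const_zero, add_zero, zero_add]

lemma rowAppend_mul_conjTranspose :
    rowAppend α α' * (rowAppend α α').conjTranspose =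
      α * α.conjTranspose + α' * α'.conjTranspose := by
  ext i j
  simp [rowAppend, Matrix.mul_apply, Fin.sum_univ_add]

lemma conjTranspose_mul_colAppend :
    (colAppend β β').conjTranspose * colAppend β β' =
      β.conjTranspose * β + β'.conjTranspose * β' := by
  ext i j
  simp [colAppend, Matrix.mul_apply, Fin.sum_univ_add]

end Append

/-- The scalar matrix `[f_ij(y_kl)]` for a matrix `f` of linear functionals. -/
def matEval {m n : ℕ} (f : Matrix (Fin n) (Fin n) (V →ₗ[ℂ] ℂ)) (y : Matrix (Fin m) (Fin m) V) :
    Matrix (Fin n × Fin m) (Fin n × Fin m) ℂ :=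
  Matrix.of fun p q => f p.1 q.1 (y p.2 q.2)

/-- Scalar matrices `a`, `b` are read as vectors indexed by pairs. Estimates for the operator norm
of `matEval f y` thereby become estimates for one scalar functional on the matrices `a y b`, and
conversely. -/
lemma sum_mul_matEval_mul {m n : ℕ} (f : Matrix (Fin n) (Fin n) (V →ₗ[ℂ] ℂ))
    (y : Matrix (Fin m) (Fin m) V) (a : Matrix (Fin n) (Fin m) ℂ) (b : Matrix (Fin m) (Fin n) ℂ) :
    ∑ p : Fin n × Fin m, a p.1 p.2 * (matEval f y).mulVec (fun q => b q.2 q.1) p =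
      ∑ i, ∑ j, f i j (matSandwich a y b i j) := by
  simp only [Matrix.mulVec, dotProduct, matEval, Matrix.of_apply, Fintype.sum_prod_type,
    matSandwich, map_sum, map_smul, smul_eq_mul, Finset.mul_sum]
  refine Finset.sum_congr rfl fun i _ => ?_
  rw [Finset.sum_comm]
  refine Finset.sum_congr rfl fun j _ => Finset.sum_congr rfl fun k _ =>
    Finset.sum_congr rfl fun l _ => ?_
  ring

end Separation

section ScalarMatrices

variable {a b : Type*} [Fintype a] [Fintype b] [DecidableEq a] [DecidableEq b]

/-- The choice `u = conj (M v)` turns the hypothesis into `‖Mv‖² ≤ (‖Mv‖² + ‖v‖²)/2`. The bound by a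
sum of squares, rather than a product, is the form in which the separating functional delivers it.
-/
lemma l2_le_one_of_re_le (M : Matrix a b ℂ)
    (h : ∀ (u : a → ℂ) (v : b → ℂ),
      (∑ i, u i * M.mulVec v i).re ≤ (∑ i, ‖u i‖ ^ 2 + ∑ j, ‖v j‖ ^ 2) / 2) : ‖M‖ ≤ 1 := by
  refine l2_le_of_sq _ _ zero_le_one fun v => ?_
  have h1 := h (fun i => star (M.mulVec v i)) v
  have h2 : (∑ i, star (M.mulVec v i) * M.mulVec v i).re = ∑ i, ‖M.mulVec v i‖ ^ 2 := by
    rw [Complex.re_sum]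
    refine Finset.sum_congr rfl fun i _ => ?_
    rw [Complex.star_def, Complex.conj_mul', ← Complex.ofReal_pow, Complex.ofReal_re]
  simp only [h2, norm_star] at h1
  linarith

lemma norm_sum_mul_mulVec_le (M : Matrix a b ℂ) (u : a → ℂ) (v : b → ℂ) {C : ℝ} (hC : 0 ≤ C)
    (hu : ∑ i, ‖u i‖ ^ 2 ≤ C) (hv : ∑ j, ‖v j‖ ^ 2 ≤ C) :
    ‖∑ i, u i * M.mulVec v i‖ ≤ ‖M‖ * C := by
  refine (norm_sum_le _ _).trans ?_
  simp only [norm_mul]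
  have h1 := Finset.sum_mul_sq_le_sq_mul_sq Finset.univ (fun i => ‖u i‖) fun i => ‖M.mulVec v i‖
  have h2 := sq_le_l2 M v
  refine (sq_le_sq₀ (by positivity) (by positivity)).mp (h1.trans ?_)
  calc _ ≤ C * (‖M‖ ^ 2 * C) := by
        gcongr
        exact h2.trans (by gcongr)
    _ = _ := by ring

end ScalarMatrices

end OperatorSpace
end

/-! ### Matrix convex sets and their separation by matrices of functionals -/

noncomputable section
namespace OperatorSpace

/-- An absorbing family of sets `B m ⊆ M_m(V)` that is closed under direct sums and under
`y ↦ α y β` for scalar contractions `α`, `β`: the unit balls of a matrix seminorm. -/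
structure IsMatrixConvex {V : Type*} [AddCommGroup V] [Module ℂ V]
    (B : ∀ m : ℕ, Set (Matrix (Fin m) (Fin m) V)) : Prop where
  directSum : ∀ {m n : ℕ} {x : Matrix (Fin m) (Fin m) V} {y : Matrix (Fin n) (Fin n) V},
    x ∈ B m → y ∈ B n → matBlocks x 0 0 y ∈ B (m + n)
  sandwich : ∀ {m n : ℕ} {α : Matrix (Fin n) (Fin m) ℂ} {x : Matrix (Fin m) (Fin m) V}
    {β : Matrix (Fin m) (Fin n) ℂ}, ‖α‖ ≤ 1 → ‖β‖ ≤ 1 → x ∈ B m → matSandwich α x β ∈ B n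
  absorbing : ∀ {m : ℕ} (x : Matrix (Fin m) (Fin m) V), ∃ c : ℝ, 0 < c ∧ (c : ℂ) • x ∈ B m

namespace IsMatrixConvex

variable {V : Type*} [AddCommGroup V] [Module ℂ V] {B : ∀ m : ℕ, Set (Matrix (Fin m) (Fin m) V)}

lemma zero_mem (hB : IsMatrixConvex B) (m : ℕ) : (0 : Matrix (Fin m) (Fin m) V) ∈ B m := by
  obtain ⟨c, -, hc⟩ := hB.absorbing (0 : Matrix (Fin m) (Fin m) V)
  rwa [smul_zero] at hc

/-- If every multiple `c x₀` in `B n` has `c ≤ 1`, then `t x₀ = α y β` forces `t ≤ ‖α‖ ‖β‖`. -/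
lemma le_mul_norm (hB : IsMatrixConvex B) {n : ℕ} {x₀ : Matrix (Fin n) (Fin n) V}
    (hx₀ : ∀ c : ℝ, 0 < c → (c : ℂ) • x₀ ∈ B n → c ≤ 1) {t : ℝ} (ht : 0 < t) {m : ℕ}
    {α : Matrix (Fin n) (Fin m) ℂ} {y : Matrix (Fin m) (Fin m) V} {β : Matrix (Fin m) (Fin n) ℂ}
    (hy : y ∈ B m) (h : matSandwich α y β = (t : ℂ) • x₀) : t ≤ ‖α‖ * ‖β‖ := by
  have main : ∀ δ : ℝ, 0 < δ → t ≤ (‖α‖ + δ) * (‖β‖ + δ) := fun δ hδ => by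
    have hα : 0 < ‖α‖ + δ := by positivity
    have hβ : 0 < ‖β‖ + δ := by positivity
    have h1 : ‖(((‖α‖ + δ)⁻¹ : ℝ) : ℂ) • α‖ ≤ 1 := by
      rw [norm_smul, Complex.norm_real, Real.norm_of_nonneg (by positivity)]
      exact inv_mul_le_one_of_le₀ (by linarith) hα.le
    have h2 : ‖(((‖β‖ + δ)⁻¹ : ℝ) : ℂ) • β‖ ≤ 1 := by
      rw [norm_smul, Complex.norm_real, Real.norm_of_nonneg (by positivity)]
      exact inv_mul_le_one_of_le₀ (by linarith) hβ.le
    have h3 := hB.sandwich h1 h2 hy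
    rw [matSandwich_smul_smul, h, smul_smul, ← Complex.ofReal_mul, ← Complex.ofReal_mul] at h3
    have h4 := hx₀ _ (by positivity) h3
    rwa [← mul_inv, inv_mul_le_iff₀ (by positivity), mul_one] at h4
  have lim : Filter.Tendsto (fun δ : ℝ => (‖α‖ + δ) * (‖β‖ + δ))
      (nhdsWithin 0 (Set.Ioi 0)) (nhds ((‖α‖ + 0) * (‖β‖ + 0))) :=
    (Continuous.tendsto (by fun_prop) 0).mono_left nhdsWithin_le_nhds
  simp only [add_zero] at lim
  exact ge_of_tendsto lim (by filter_upwards [self_mem_nhdsWithin] with δ hδ using main δ hδ)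

/-- The values whose infimum is the sublinear functional of `exists_factorization_functional`. -/
def bounds (B : ∀ m : ℕ, Set (Matrix (Fin m) (Fin m) V)) {n : ℕ}
    (u : Matrix (Fin n) (Fin n) V × Matrix (Fin n) (Fin n) ℂ × Matrix (Fin n) (Fin n) ℂ) :
    Set ℝ :=
  {r | ∃ (m : ℕ) (α : Matrix (Fin n) (Fin m) ℂ) (y : Matrix (Fin m) (Fin m) V)
    (β : Matrix (Fin m) (Fin n) ℂ), y ∈ B m ∧ matSandwich α y β = u.1 ∧
    r = ‖u.2.1 + α * α.conjTranspose‖ + ‖u.2.2 + β.conjTranspose * β‖}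

section Bounds

variable {n : ℕ}
  (u w : Matrix (Fin n) (Fin n) V × Matrix (Fin n) (Fin n) ℂ × Matrix (Fin n) (Fin n) ℂ)

lemma bounds_nonneg : ∀ r ∈ bounds B u, 0 ≤ r := by
  rintro r ⟨m, α, y, β, -, -, rfl⟩
  positivity

lemma bddBelow_bounds : BddBelow (bounds B u) := ⟨0, fun r hr => bounds_nonneg u r hr⟩

lemma bounds_nonempty (hB : IsMatrixConvex B) : (bounds B u).Nonempty := by
  obtain ⟨c, hc, hx⟩ := hB.absorbing u.1
  refine ⟨_, n, ((c⁻¹ : ℝ) : ℂ) • 1, (c : ℂ) • u.1, (1 : ℂ) • 1, hx, ?_, rfl⟩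
  have := matSandwich_one_submatrix id id ((c : ℂ) • u.1)
  simp only [Matrix.submatrix_id_id] at this
  rw [matSandwich_smul_smul, this, mul_one, smul_smul, ← Complex.ofReal_mul,
    inv_mul_cancel₀ hc.ne', Complex.ofReal_one, one_smul]

/-- Putting `√c` on each of `α` and `β` multiplies `α y β`, `αα*` and `β*β` all by `c`. -/
lemma mul_mem_bounds {c : ℝ} (hc : 0 < c) {r : ℝ} (hr : r ∈ bounds B u) :
    c * r ∈ bounds B (c • u) := by
  obtain ⟨m, α, y, β, hy, h1, rfl⟩ := hr
  have hs : ((Real.sqrt c : ℝ) : ℂ) * ((Real.sqrt c : ℝ) : ℂ) = (c : ℂ) := by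
    rw [← Complex.ofReal_mul, Real.mul_self_sqrt hc.le]
  refine ⟨m, ((Real.sqrt c : ℝ) : ℂ) • α, y, ((Real.sqrt c : ℝ) : ℂ) • β, hy, ?_, ?_⟩
  · rw [matSandwich_smul_smul, h1, hs]
    rfl
  · have e1 : (c • u).2.1 + (((Real.sqrt c : ℝ) : ℂ) • α) *
        (((Real.sqrt c : ℝ) : ℂ) • α).conjTranspose = c • (u.2.1 + α * α.conjTranspose) := by
      rw [Matrix.conjTranspose_smul, Matrix.smul_mul, Matrix.mul_smul, smul_smul,
        Complex.star_def, Complex.conj_ofReal, hs, smul_add]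
      rfl
    have e2 : (c • u).2.2 + (((Real.sqrt c : ℝ) : ℂ) • β).conjTranspose *
        (((Real.sqrt c : ℝ) : ℂ) • β) = c • (u.2.2 + β.conjTranspose * β) := by
      rw [Matrix.conjTranspose_smul, Matrix.smul_mul, Matrix.mul_smul, smul_smul,
        Complex.star_def, Complex.conj_ofReal, hs, smul_add]
      rfl
    rw [e1, e2, norm_smul, norm_smul, Real.norm_of_nonneg hc.le, mul_add]

lemma sInf_bounds_smul_le (hB : IsMatrixConvex B) {c : ℝ} (hc : 0 < c) :
    sInf (bounds B (c • u)) ≤ c * sInf (bounds B u) := by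
  rw [mul_comm, ← div_le_iff₀ hc]
  refine le_csInf (bounds_nonempty u hB) fun r hr => ?_
  rw [div_le_iff₀ hc, mul_comm]
  exact csInf_le (bddBelow_bounds _) (mul_mem_bounds u hc hr)

lemma sInf_bounds_smul (hB : IsMatrixConvex B) {c : ℝ} (hc : 0 < c) :
    sInf (bounds B (c • u)) = c * sInf (bounds B u) := by
  refine le_antisymm (sInf_bounds_smul_le u hB hc) ?_
  have h := sInf_bounds_smul_le (c • u) hB (inv_pos.mpr hc)
  rwa [smul_smul, inv_mul_cancel₀ hc.ne', one_smul, ← div_eq_inv_mul, le_div_iff₀ hc,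
    mul_comm] at h

/-- Subadditivity comes from direct sums: the row `[α α']`, the matrix `y ⊕ y'` and the column `[β;
β']` represent the sum, and the squares `αα*`, `β*β` add as well. -/
lemma sInf_bounds_add_le (hB : IsMatrixConvex B) :
    sInf (bounds B (u + w)) ≤ sInf (bounds B u) + sInf (bounds B w) := by
  rw [← sub_le_iff_le_add]
  refine le_csInf (bounds_nonempty u hB) fun r hr => ?_
  rw [sub_le_comm]
  refine le_csInf (bounds_nonempty w hB) fun r' hr' => ?_
  rw [sub_le_iff_le_add']
  obtain ⟨m, α, y, β, hy, h1, rfl⟩ := hr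
  obtain ⟨m', α', y', β', hy', h1', rfl⟩ := hr'
  refine (csInf_le (bddBelow_bounds _) ⟨m + m', rowAppend α α', matBlocks y 0 0 y',
    colAppend β β', hB.directSum hy hy', ?_, rfl⟩).trans ?_
  · rw [matSandwich_append, h1, h1']
    rfl
  · rw [rowAppend_mul_conjTranspose, conjTranspose_mul_colAppend, Prod.snd_add, Prod.fst_add,
      Prod.snd_add, add_add_add_comm u.2.1, add_add_add_comm u.2.2]
    refine (add_le_add (norm_add_le _ _) (norm_add_le _ _)).trans (le_of_eq ?_)
    ring

end Bounds

/-- A functional on `M_n(V)` that is large at `x₀` and bounded on all `α y β`, `y ∈ B m`, by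
functionals of `αα*` and `β*β`. -/
lemma exists_factorization_functional (hB : IsMatrixConvex B) {n : ℕ}
    {x₀ : Matrix (Fin n) (Fin n) V} (hx₀ : ∀ c : ℝ, 0 < c → (c : ℂ) • x₀ ∈ B n → c ≤ 1) :
    ∃ (φ : Matrix (Fin n) (Fin n) V →ₗ[ℝ] ℝ) (p q : Matrix (Fin n) (Fin n) ℂ →ₗ[ℝ] ℝ),
      φ x₀ = 2 ∧ (∀ A, p A ≤ ‖A‖) ∧ (∀ A, q A ≤ ‖A‖) ∧
      ∀ (m : ℕ) (α : Matrix (Fin n) (Fin m) ℂ) (y : Matrix (Fin m) (Fin m) V)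
        (β : Matrix (Fin m) (Fin n) ℂ), y ∈ B m →
        φ (matSandwich α y β) ≤ p (α * α.conjTranspose) + q (β.conjTranspose * β) := by
  have hne : x₀ ≠ 0 := by
    rintro rfl
    have := hx₀ 2 two_pos (by rw [smul_zero]; exact hB.zero_mem n)
    norm_num at this
  set u₀ : Matrix (Fin n) (Fin n) V × Matrix (Fin n) (Fin n) ℂ × Matrix (Fin n) (Fin n) ℂ :=
    (x₀, 0, 0) with hu₀
  have hu0 : u₀ ≠ 0 := fun h => hne (congrArg Prod.fst h)
  -- The two scalar matrix variables let a single Hahn–Banach extension produce `φ` together with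
  -- its dominating functionals `p` and `q`.
  obtain ⟨G, hG, hGS⟩ := exists_extension_of_le_sublinear
    (LinearPMap.mkSpanSingleton (K := ℝ) u₀ (2 : ℝ) hu0) (fun u => sInf (bounds B u))
    (fun c hc u => sInf_bounds_smul u hB hc) (fun u w => sInf_bounds_add_le u w hB) (by
      rintro ⟨u, hu⟩
      obtain ⟨t, rfl⟩ := Submodule.mem_span_singleton.mp hu
      have hval : LinearPMap.mkSpanSingleton (K := ℝ) u₀ (2 : ℝ) hu0 ⟨t • u₀, hu⟩ = t * 2 :=
        LinearPMap.mkSpanSingleton'_apply _ _ _ t hu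
      rw [hval]
      rcases le_or_gt t 0 with ht | ht
      · exact le_trans (by linarith) (Real.sInf_nonneg (bounds_nonneg _))
      · refine le_csInf (bounds_nonempty _ hB) ?_
        rintro r ⟨m, α, y, β, hy, h1, rfl⟩
        -- Here `r = ‖α‖² + ‖β‖² ≥ 2‖α‖‖β‖ ≥ 2t`, which is why the value prescribed at `x₀` is `2`.
        have h2 := hB.le_mul_norm hx₀ ht hy h1
        have h3 : ‖α * α.conjTranspose‖ = ‖α‖ * ‖α‖ := by
          have := Matrix.l2_opNorm_conjTranspose_mul_self α.conjTranspose
          rwa [Matrix.conjTranspose_conjTranspose, Matrix.l2_opNorm_conjTranspose] at this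
        have h4 := Matrix.l2_opNorm_conjTranspose_mul_self β
        have e1 : (t • u₀).2.1 = 0 := smul_zero t
        have e2 : (t • u₀).2.2 = 0 := smul_zero t
        simp only [e1, e2, zero_add, h3, h4]
        nlinarith [sq_nonneg (‖α‖ - ‖β‖)])
  refine ⟨G ∘ₗ LinearMap.inl ℝ _ _, G ∘ₗ LinearMap.inr ℝ _ _ ∘ₗ LinearMap.inl ℝ _ _,
    G ∘ₗ LinearMap.inr ℝ _ _ ∘ₗ LinearMap.inr ℝ _ _, ?_, fun A => ?_, fun A => ?_,
    fun m α y β hy => ?_⟩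
  · have h := hG ⟨u₀, Submodule.mem_span_singleton_self _⟩
    rw [LinearPMap.mkSpanSingleton_apply] at h
    exact h
  · exact (hGS _).trans (csInf_le (bddBelow_bounds _)
      ⟨n, 0, 0, 0, hB.zero_mem n, matSandwich_zero_left _ _, by simp⟩)
  · exact (hGS _).trans (csInf_le (bddBelow_bounds _)
      ⟨n, 0, 0, 0, hB.zero_mem n, matSandwich_zero_left _ _, by simp⟩)
  -- With `-αα*` and `-β*β` in the scalar slots, the representation `α y β` itself gives the bound
  -- `0`.
  · have h := (hGS (matSandwich α y β, -(α * α.conjTranspose), -(β.conjTranspose * β))).trans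
      (csInf_le (bddBelow_bounds _) ⟨m, α, y, β, hy, rfl, rfl⟩)
    simp only [neg_add_cancel, norm_zero, add_zero] at h
    have e : (matSandwich α y β, -(α * α.conjTranspose), -(β.conjTranspose * β)) =
        LinearMap.inl ℝ _ _ (matSandwich α y β)
        - LinearMap.inr ℝ _ _ (LinearMap.inl ℝ _ _ (α * α.conjTranspose))
        - LinearMap.inr ℝ (Matrix (Fin n) (Fin n) V) _
          (LinearMap.inr ℝ (Matrix (Fin n) (Fin n) ℂ) _ (β.conjTranspose * β)) := by
      simp
    rw [e, map_sub, map_sub] at h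
    simp only [LinearMap.comp_apply]
    linarith

/-- The matrix separation theorem: a matrix outside the interior of `B n` is separated from all
`B m` by a matrix of functionals. -/
theorem exists_matEval_separating (hB : IsMatrixConvex B) {n : ℕ}
    {x₀ : Matrix (Fin n) (Fin n) V} (hx₀ : ∀ c : ℝ, 0 < c → (c : ℂ) • x₀ ∈ B n → c ≤ 1)
    {ε : ℝ} (hε : 0 < ε) :
    ∃ f : Matrix (Fin n) (Fin n) (V →ₗ[ℂ] ℂ), (∀ m, ∀ y ∈ B m, ‖matEval f y‖ ≤ 1) ∧
      1 ≤ ‖matEval f x₀‖ * (1 + ε) := by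
  obtain ⟨φ, p, q, hφ, hp, hq, hle⟩ := hB.exists_factorization_functional hx₀
  have hp0 : ∀ α : Matrix (Fin n) (Fin 1) ℂ, 0 ≤ p (α * α.conjTranspose) := fun α => by
    have := hle 1 α 0 0 (hB.zero_mem 1)
    have e : matSandwich α (0 : Matrix (Fin 1) (Fin 1) V) (0 : Matrix (Fin 1) (Fin n) ℂ) = 0 := by
      ext; simp [matSandwich]
    simpa [e] using this
  have hq0 : ∀ α : Matrix (Fin n) (Fin 1) ℂ, 0 ≤ q (α * α.conjTranspose) := fun α => by
    have := hle 1 0 0 α.conjTranspose (hB.zero_mem 1)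
    simpa [matSandwich_zero_left] using this
  obtain ⟨R, hR, hRn, hRp⟩ := exists_isUnit_dominating p hp0 ((hp 1).trans l2_one_le) hε
  obtain ⟨D, hD, hDn, hDq⟩ := exists_isUnit_dominating q hq0 ((hq 1).trans l2_one_le) hε
  have hRi : R * R⁻¹ = 1 := Matrix.mul_nonsing_inv _ ((Matrix.isUnit_iff_isUnit_det _).mp hR)
  have hRi' : R⁻¹ * R = 1 := Matrix.nonsing_inv_mul _ ((Matrix.isUnit_iff_isUnit_det _).mp hR)
  have hDi : D * D⁻¹ = 1 := Matrix.mul_nonsing_inv _ ((Matrix.isUnit_iff_isUnit_det _).mp hD)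
  set φc : Matrix (Fin n) (Fin n) V →ₗ[ℂ] ℂ := Module.Dual.extendRCLike (𝕜 := ℂ) φ with hφc
  have hre : ∀ x, (φc x).re = φ x := fun x => Module.Dual.re_extendRCLike_apply (𝕜 := ℂ) φ x
  -- Since `p (αα*)` and `q (β*β)` are dominated by the squared Hilbert–Schmidt norms of `Rα` and
  -- `Dβ*`, composing with `R⁻¹ · (D⁻¹)*` leaves the plain norms of the test vectors. The factor
  -- `1/2` fits `l2_le_one_of_re_le`.
  set ψ : Matrix (Fin n) (Fin n) V →ₗ[ℂ] ℂ :=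
    (1 / 2 : ℂ) • (φc ∘ₗ matSandwichLinear R⁻¹ (D⁻¹).conjTranspose) with hψ
  have hψre : ∀ x, (ψ x).re = φ (matSandwich R⁻¹ x (D⁻¹).conjTranspose) / 2 := fun x => by
    have : ψ x = (1 / 2 : ℂ) * φc (matSandwich R⁻¹ x (D⁻¹).conjTranspose) := rfl
    rw [this, ← hre]
    simp [div_eq_inv_mul]
  set f : Matrix (Fin n) (Fin n) (V →ₗ[ℂ] ℂ) :=
    Matrix.of fun i j => ψ ∘ₗ Matrix.singleLinearMap ℂ i j with hf
  have hfψ : ∀ x : Matrix (Fin n) (Fin n) V, ∑ i, ∑ j, f i j (x i j) = ψ x := fun x => by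
    conv_rhs => rw [Matrix.matrix_eq_sum_single x]
    simp [hf]
  refine ⟨f, fun m y hy => l2_le_one_of_re_le _ fun a b => ?_, ?_⟩
  · have h1 := sum_mul_matEval_mul f y (Matrix.of fun i k => a (i, k))
      (Matrix.of fun l j => b (j, l))
    simp only [Matrix.of_apply, Prod.mk.eta] at h1
    rw [h1, hfψ, hψre, matSandwich_matSandwich]
    have h2 := hle m (R⁻¹ * Matrix.of fun i k => a (i, k)) y
      ((Matrix.of fun l j => b (j, l)) * (D⁻¹).conjTranspose) hy
    have h3 := hRp m (R⁻¹ * Matrix.of fun i k => a (i, k))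
    have h4 := hDq m (D⁻¹ * (Matrix.of fun l j => b (j, l) :
      Matrix (Fin m) (Fin n) ℂ).conjTranspose)
    rw [← Matrix.mul_assoc, hRi, Matrix.one_mul] at h3
    rw [← Matrix.mul_assoc, hDi, Matrix.one_mul] at h4
    simp only [Matrix.conjTranspose_mul, Matrix.conjTranspose_conjTranspose,
      Matrix.conjTranspose_apply, norm_star, Matrix.of_apply] at h2 h3 h4
    rw [Fintype.sum_prod_type, Fintype.sum_prod_type]
    linarith
  -- Testing on the vectors `R` and `D*`, of squared norm at most `1 + ε`, undoes the inverses: the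
  -- result has real part `φ x₀ / 2 = 1`.
  · have h1 := sum_mul_matEval_mul f x₀ R D.conjTranspose
    have h2 := norm_sum_mul_mulVec_le (matEval f x₀) (fun p => R p.1 p.2)
      (fun q => D.conjTranspose q.2 q.1) (C := 1 + ε) (by positivity)
      (by rw [Fintype.sum_prod_type]; exact hRn)
      (by simpa [Fintype.sum_prod_type] using hDn)
    rw [h1, hfψ] at h2
    refine le_trans ?_ h2
    refine le_trans ?_ ((Complex.re_le_norm _))
    have e : matSandwich (1 : Matrix (Fin n) (Fin n) ℂ) x₀ (1 : Matrix (Fin n) (Fin n) ℂ) = x₀ := by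
      have := matSandwich_one_submatrix id id x₀
      simpa only [Matrix.submatrix_id_id] using this
    rw [hψre, matSandwich_matSandwich, hRi', ← Matrix.conjTranspose_mul,
      Matrix.nonsing_inv_mul _ ((Matrix.isUnit_iff_isUnit_det _).mp hD),
      Matrix.conjTranspose_one, e, hφ]
    norm_num

end IsMatrixConvex
end OperatorSpace
end

/-! ### The bidual embedding, and contractive projections onto `M`-ideals -/

noncomputable section
namespace OperatorSpace

lemma l2_entry_le {a b : Type*} [Fintype a] [Fintype b] [DecidableEq a] [DecidableEq b]
    (A : Matrix a b ℂ) (i : a) (j : b) : ‖A i j‖ ≤ ‖A‖ := by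
  have h := sq_le_l2 A (Pi.single j 1)
  have h1 : ∑ k, ‖(Pi.single j (1 : ℂ) : b → ℂ) k‖ ^ 2 = 1 := by
    rw [Finset.sum_eq_single j] <;> simp +contextual
  rw [h1, mul_one, Matrix.mulVec_single_one] at h
  refine (sq_le_sq₀ (norm_nonneg _) (norm_nonneg _)).mp (le_trans ?_ h)
  exact Finset.single_le_sum (f := fun i => ‖A i j‖ ^ 2) (fun _ _ => by positivity)
    (Finset.mem_univ i)

section UnitBall

variable {E : Type*} [NormedAddCommGroup E] [NormedSpace ℂ E]

/-- A linear functional that is bounded by one on the unit ball, as a continuous functional. -/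
def unitBallFunctional (f : E →ₗ[ℂ] ℂ) (hf : ∀ v, ‖v‖ ≤ 1 → ‖f v‖ ≤ 1) : StrongDual ℂ E :=
  f.mkContinuous 1 fun v => by
    rcases eq_or_ne v 0 with rfl | hv
    · simp
    · have hv0 : 0 < ‖v‖ := norm_pos_iff.mpr hv
      have h := hf (((‖v‖⁻¹ : ℝ) : ℂ) • v) (by
        rw [norm_smul, Complex.norm_real, Real.norm_of_nonneg (by positivity),
          inv_mul_cancel₀ hv0.ne'])
      rwa [map_smul, norm_smul, Complex.norm_real, Real.norm_of_nonneg (by positivity),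
        inv_mul_le_iff₀ hv0, mul_one, ← one_mul ‖v‖] at h

lemma unitBallFunctional_apply (f : E →ₗ[ℂ] ℂ) (hf : ∀ v, ‖v‖ ≤ 1 → ‖f v‖ ≤ 1) (v : E) :
    unitBallFunctional f hf v = f v := rfl

end UnitBall

variable {X : Type*} [NormedAddCommGroup X] [NormedSpace ℂ X] [OperatorSpace X]

lemma norm_matPairing_le {m n : ℕ} (f : Matrix (Fin n) (Fin n) (StrongDual ℂ X))
    (x : Matrix (Fin m) (Fin m) X) : ‖matPairing f x‖ ≤ matNorm n f * matNorm m x := by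
  rcases (apply_nonneg (matNorm (X := X) m) x).eq_or_lt with h | h
  · rw [eq_zero_of_matNorm_eq_zero x h.symm, map_zero, mul_zero]
    have : matPairing f (0 : Matrix (Fin m) (Fin m) X) = 0 := by ext p q; simp [matPairing]
    rw [this, norm_zero]
  · set r := matNorm m x
    have h1 := norm_matPairing_le_sSup f (((r⁻¹ : ℝ) : ℂ) • x) (by
      rw [map_smul_eq_mul, Complex.norm_real, Real.norm_of_nonneg (by positivity)]
      exact (inv_mul_cancel₀ h.ne').le)
    have h2 : matPairing f (((r⁻¹ : ℝ) : ℂ) • x) = ((r⁻¹ : ℝ) : ℂ) • matPairing f x := by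
      ext p q; simp [matPairing]
    rw [h2, norm_smul, Complex.norm_real, Real.norm_of_nonneg (by positivity),
      inv_mul_le_iff₀ h, mul_comm] at h1
    exact h1

variable (X) in
/-- The closed unit balls of an operator space. -/
lemma isMatrixConvex_closedBall :
    IsMatrixConvex fun m => {x : Matrix (Fin m) (Fin m) X | matNorm m x ≤ 1} where
  directSum := by
    intro m n x y hx hy
    rw [Set.mem_ofPred_eq, matNorm_directSum]
    exact max_le hx hy
  sandwich hα hβ hx := (matNorm_sandwich_le_of_le _ hα hβ).trans hx
  absorbing := by
    intro m x
    have h0 := apply_nonneg (matNorm (X := X) m) x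
    refine ⟨(matNorm m x + 1)⁻¹, by positivity, ?_⟩
    rw [Set.mem_ofPred_eq, map_smul_eq_mul, Complex.norm_real,
      Real.norm_of_nonneg (by positivity)]
    exact inv_mul_le_one_of_le₀ (by linarith) (by positivity)

/-- The dual unit balls norm the matrix spaces. -/
lemma exists_matPairing_ge {n : ℕ} (x : Matrix (Fin n) (Fin n) X) {ε : ℝ} (hε : 0 < ε) :
    ∃ f : Matrix (Fin n) (Fin n) (StrongDual ℂ X), matNorm n f ≤ 1 ∧
      matNorm n x ≤ ‖matPairing f x‖ * (1 + ε) := by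
  rcases (apply_nonneg (matNorm (X := X) n) x).eq_or_lt with h | h
  · exact ⟨0, by rw [map_zero]; exact zero_le_one, by rw [← h]; positivity⟩
  set r := matNorm n x with hr
  obtain ⟨f, hf, hfx⟩ := (isMatrixConvex_closedBall X).exists_matEval_separating
    (x₀ := ((r⁻¹ : ℝ) : ℂ) • x) (fun c hc hcx => by
      rwa [Set.mem_ofPred_eq, map_smul_eq_mul, map_smul_eq_mul, Complex.norm_real,
        Complex.norm_real, Real.norm_of_nonneg hc.le, Real.norm_of_nonneg (by positivity), ← hr,
        inv_mul_cancel₀ h.ne', mul_one] at hcx) hε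
  -- The separating functionals are only linear; contractivity on `1 × 1` matrices makes each entry
  -- continuous.
  have hb : ∀ i j v, ‖v‖ ≤ 1 → ‖f i j v‖ ≤ 1 := fun i j v hv =>
    (l2_entry_le (matEval f (Matrix.of fun (_ _ : Fin 1) => v)) (i, 0) (j, 0)).trans
      (hf 1 _ (by rwa [Set.mem_ofPred_eq, matNorm_one]))
  refine ⟨Matrix.of fun i j => unitBallFunctional (f i j) (hb i j),
    sSup_dualNormSet_le _ _ zero_le_one fun m y hy => hf m y hy, ?_⟩
  have e : matEval f (((r⁻¹ : ℝ) : ℂ) • x) = ((r⁻¹ : ℝ) : ℂ) • matEval f x := by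
    ext p q; simp [matEval]
  rw [e, norm_smul, Complex.norm_real, Real.norm_of_nonneg (by positivity), mul_assoc,
    ← div_eq_inv_mul, le_div_iff₀ h, one_mul] at hfx
  exact hfx

lemma matNorm_le_of_matPairing_le {n : ℕ} (x : Matrix (Fin n) (Fin n) X) {C : ℝ}
    (h : ∀ (m : ℕ) (f : Matrix (Fin m) (Fin m) (StrongDual ℂ X)), matNorm m f ≤ 1 →
      ‖matPairing f x‖ ≤ C) : matNorm n x ≤ C := by
  have lim : Filter.Tendsto (fun δ : ℝ => C * (1 + δ))
      (nhdsWithin 0 (Set.Ioi 0)) (nhds (C * (1 + 0))) :=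
    (Continuous.tendsto (by fun_prop) 0).mono_left nhdsWithin_le_nhds
  rw [add_zero, mul_one] at lim
  refine ge_of_tendsto lim ?_
  filter_upwards [self_mem_nhdsWithin] with δ hδ
  have hδ : 0 < δ := hδ
  obtain ⟨f, hf, hfx⟩ := exists_matPairing_ge x hδ
  exact hfx.trans (by gcongr; exact h n f hf)

variable (X) in
/-- The canonical embedding into the bidual is a complete isometry. -/
theorem isCompleteIsometry_inclusionInDoubleDual :
    IsCompleteIsometry (F := StrongDual ℂ (StrongDual ℂ X))
      (NormedSpace.inclusionInDoubleDual ℂ X).toLinearMap := by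
  intro n x
  -- The two pairings differ only by exchanging the tensor factors of `M_n ⊗ M_m`.
  have key : ∀ (m : ℕ) (f : Matrix (Fin m) (Fin m) (StrongDual ℂ X)),
      ‖matPairing (x.map (NormedSpace.inclusionInDoubleDual ℂ X)) f‖ = ‖matPairing f x‖ :=
    fun m f => by
      rw [← l2_reindex (Equiv.prodComm _ _) (Equiv.prodComm _ _) (matPairing f x)]
      congr 1
  refine le_antisymm (sSup_dualNormSet_le _ _ (apply_nonneg _ _) fun m f hf => ?_)
    (matNorm_le_of_matPairing_le x fun m f hf => ?_)
  · exact (key m f).trans_le ((norm_matPairing_le f x).trans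
      (mul_le_of_le_one_left (apply_nonneg _ _) hf))
  · rw [← key]
    exact norm_matPairing_le_sSup _ f hf

/-- Being a complete left `M`-projection passes to restrictions along complete isometries. -/
lemma IsCompleteLeftMProjection.of_isCompleteIsometry {Y : Type*} [NormedAddCommGroup Y]
    [NormedSpace ℂ Y] [OperatorSpace Y] {P : Y →ₗ[ℂ] Y} {Q : X →ₗ[ℂ] X}
    (hP : IsCompleteLeftMProjection P) {ι : X →ₗ[ℂ] Y} (hι : IsCompleteIsometry ι)
    (h : ∀ x, P (ι x) = ι (Q x)) : IsCompleteLeftMProjection Q := by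
  have inj : ∀ x y, ι x = ι y → x = y := fun x y hxy => by
    have h1 := hι 1 (Matrix.of fun _ _ => x - y)
    rw [matNorm_one] at h1
    have h2 : (Matrix.of fun (_ _ : Fin 1) => x - y).map ι = 0 := by
      ext; simp [hxy]
    rw [h2, map_zero] at h1
    exact sub_eq_zero.mp (norm_eq_zero.mp h1.symm)
  refine ⟨LinearMap.ext fun x => inj _ _ ?_, fun n x => ?_⟩
  · rw [LinearMap.comp_apply, ← h, ← h]
    exact LinearMap.congr_fun hP.1 (ι x)
  · rw [← hι, hP.2]
    have e : matBlocks ((x.map ι).map P) (0 : Matrix (Fin n) (Fin n) Y)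
        (x.map ι - (x.map ι).map P) 0 = (matBlocks (x.map Q) 0 (x - x.map Q) 0).map ι := by
      ext i j
      refine Fin.addCases (fun i => ?_) (fun i => ?_) i <;>
        refine Fin.addCases (fun j => ?_) (fun j => ?_) j <;>
        simp only [Matrix.map_apply, matBlocks_castAdd_castAdd, matBlocks_castAdd_natAdd,
          matBlocks_natAdd_castAdd, matBlocks_natAdd_natAdd, Matrix.zero_apply, map_zero,
          Matrix.sub_apply, map_sub, h]
    rw [colNorm, e, hι]
    rfl

section Banach

variable {E : Type*} [NormedAddCommGroup E] [NormedSpace ℂ E]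

/-- The adjoint of a bounded operator. -/
def dualOp (T : E →L[ℂ] E) : StrongDual ℂ E →L[ℂ] StrongDual ℂ E :=
  ContinuousLinearMap.precomp ℂ T

@[simp]
lemma dualOp_apply (T : E →L[ℂ] E) (f : StrongDual ℂ E) (x : E) : dualOp T f x = f (T x) := rfl

lemma isContractiveProjection_dualOp {T : E →L[ℂ] E}
    (hT : IsContractiveProjection (T : E →ₗ[ℂ] E)) :
    IsContractiveProjection (dualOp T : StrongDual ℂ E →ₗ[ℂ] StrongDual ℂ E) := by
  refine ⟨?_, fun f => f.opNorm_comp_le T |>.trans ?_⟩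
  · ext f x
    exact congrArg f (LinearMap.congr_fun hT.1 x)
  · refine mul_le_of_le_one_right (norm_nonneg _) (T.opNorm_le_bound zero_le_one fun x => ?_)
    rw [one_mul]
    exact hT.2 x

/-- A contractive projection as a bounded operator. -/
def IsContractiveProjection.toCLM {Q : E →ₗ[ℂ] E} (hQ : IsContractiveProjection Q) : E →L[ℂ] E :=
  Q.mkContinuous 1 fun x => by rw [one_mul]; exact hQ.2 x

@[simp]
lemma IsContractiveProjection.toCLM_apply {Q : E →ₗ[ℂ] E} (hQ : IsContractiveProjection Q)
    (x : E) : hQ.toCLM x = Q x := rfl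

/-- The adjoint `Q*` kills the annihilator of `Ran Q`, and `Q*f - f` always lies in it. So `Q**`
maps into the second annihilator and fixes it pointwise. -/
lemma range_dualOp_dualOp {Q : E →ₗ[ℂ] E} (hQ : IsContractiveProjection Q) :
    LinearMap.range (dualOp (dualOp hQ.toCLM) : StrongDual ℂ (StrongDual ℂ E) →ₗ[ℂ] _) =
      StrongDual.polarSubmodule ℂ (StrongDual.polarSubmodule ℂ (LinearMap.range Q)) := by
  have hQQ : ∀ x, Q (Q x) = Q x := fun x => LinearMap.congr_fun hQ.1 x
  ext F
  rw [StrongDual.mem_polarSubmodule]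
  constructor
  · rintro ⟨G, rfl⟩ f hf
    rw [StrongDual.mem_polarSubmodule] at hf
    have : dualOp hQ.toCLM f = 0 := by
      ext x; exact hf _ ⟨x, rfl⟩
    change G (dualOp hQ.toCLM f) = 0
    rw [this, map_zero]
  · intro hF
    refine ⟨F, ?_⟩
    ext f
    change F (dualOp hQ.toCLM f) = F f
    rw [← sub_eq_zero, ← map_sub]
    refine hF _ ((StrongDual.mem_polarSubmodule _ _ _).mpr ?_)
    rintro _ ⟨x, rfl⟩
    simp [hQQ]

end Banach

/-- This is the uniqueness of contractive projections, applied in `X**`; it reduces both (c) and (e)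
to second adjoints. -/
lemma dualOp_dualOp_eq {P : StrongDual ℂ (StrongDual ℂ X) →ₗ[ℂ] StrongDual ℂ (StrongDual ℂ X)}
    (hP : IsCompleteLeftMProjection (X := StrongDual ℂ (StrongDual ℂ X)) P) {Q : X →ₗ[ℂ] X}
    (hQ : IsContractiveProjection Q)
    (h : LinearMap.range P =
      StrongDual.polarSubmodule ℂ (StrongDual.polarSubmodule ℂ (LinearMap.range Q))) :
    P = dualOp (dualOp hQ.toCLM) :=
  hP.eq_of_range_eq (isContractiveProjection_dualOp (isContractiveProjection_dualOp hQ))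
    ((range_dualOp_dualOp hQ).trans h.symm)

/-- A contractive projection onto a complete right `M`-ideal is a complete left
`M`-projection. -/
theorem IsCompleteRightMIdeal.isCompleteLeftMProjection {J : Submodule ℂ X}
    (hJ : IsCompleteRightMIdeal J) {Q : X →ₗ[ℂ] X} (hQ : IsContractiveProjection Q)
    (hQJ : LinearMap.range Q = J) : IsCompleteLeftMProjection Q := by
  obtain ⟨-, P, hP, hPJ⟩ := hJ
  have hPQ := dualOp_dualOp_eq hP hQ (by rw [hPJ, hQJ])
  refine hP.of_isCompleteIsometry
    (isCompleteIsometry_inclusionInDoubleDual X) fun x => ?_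
  rw [hPQ]
  rfl

/-- `P x` is an entry of a column whose norm is `‖x‖`. -/
lemma IsCompleteLeftMProjection.norm_apply_le {P : X →ₗ[ℂ] X} (hP : IsCompleteLeftMProjection P)
    (x : X) : ‖P x‖ ≤ ‖x‖ := by
  have h := hP.2 1 (Matrix.of fun _ _ => x)
  rw [matNorm_one] at h
  rw [h]
  exact norm_entry_le (matBlocks ((Matrix.of fun _ _ => x : Matrix (Fin 1) (Fin 1) X).map P) 0
    ((Matrix.of fun _ _ => x : Matrix (Fin 1) (Fin 1) X) - (Matrix.of fun _ _ => x).map P) 0)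
    (Fin.castAdd 1 0) (Fin.castAdd 1 0) |>.trans' (by rw [matBlocks_castAdd_castAdd]; rfl)

lemma apply_eq_self_of_mem_range {E : Type*} [AddCommGroup E] [Module ℂ E] {P : E →ₗ[ℂ] E}
    (hP : P ∘ₗ P = P) {x : E} (hx : x ∈ LinearMap.range P) : P x = x := by
  obtain ⟨y, rfl⟩ := hx
  exact LinearMap.congr_fun hP y

lemma inclusionInDoubleDual_mem_polarSubmodule {E : Type*} [NormedAddCommGroup E]
    [NormedSpace ℂ E] {J : Submodule ℂ E} {x : E} (hx : x ∈ J) :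
    NormedSpace.inclusionInDoubleDual ℂ E x ∈
      StrongDual.polarSubmodule ℂ (StrongDual.polarSubmodule ℂ J) := by
  rw [StrongDual.mem_polarSubmodule]
  exact fun f hf => (StrongDual.mem_polarSubmodule ℂ J f).mp hf x hx

/-- There is a contractive projection onto a complete right `M`-ideal that is isometric to a
dual Banach space. -/
theorem IsCompleteRightMIdeal.exists_isContractiveProjection {J : Submodule ℂ X}
    (hJ : IsCompleteRightMIdeal J) {Z : Type*} [NormedAddCommGroup Z] [NormedSpace ℂ Z]
    (θ : J ≃ₗᵢ[ℂ] StrongDual ℂ Z) :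
    ∃ Q : X →ₗ[ℂ] X, IsContractiveProjection Q ∧ LinearMap.range Q = J := by
  obtain ⟨-, P, hP, hPJ⟩ := hJ
  -- Each `z` is a functional on `J` through `θ`; Hahn–Banach extends it to `X` without increasing
  -- the bound. The chosen extension need not depend linearly on `z`.
  have hext : ∀ z : Z, ∃ g : StrongDual ℂ X, (∀ j : J, g j = θ j z) ∧ ‖g‖ ≤ ‖z‖ := fun z => by
    obtain ⟨g, hg, hgn⟩ := exists_extension_norm_eq (𝕜 := ℂ) J
      ((NormedSpace.inclusionInDoubleDual ℂ Z z).comp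
        (θ.toContinuousLinearEquiv : J →L[ℂ] StrongDual ℂ Z))
    refine ⟨g, hg, hgn.le.trans (ContinuousLinearMap.opNorm_le_bound _ (norm_nonneg _) fun j => ?_)⟩
    refine ((θ j).le_opNorm z).trans ?_
    rw [θ.norm_map, mul_comm]
  choose g hg hgn using hext
  set ι := NormedSpace.inclusionInDoubleDual ℂ X
  have hmem : ∀ x, P (ι x) ∈ StrongDual.polarSubmodule ℂ (StrongDual.polarSubmodule ℂ J) :=
    fun x => hPJ ▸ ⟨_, rfl⟩
  -- Two extensions of the same functional differ by an element of `J^⊥`, which `P (ι x) ∈ J^⊥⊥`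
  -- annihilates. Hence `z ↦ P (ι x) (g z)` is linear although `g` need not be.
  have hzero : ∀ x (f : StrongDual ℂ X), (∀ j ∈ J, f j = 0) → P (ι x) f = 0 := fun x f hf =>
    (StrongDual.mem_polarSubmodule ℂ _ _).mp (hmem x) f
      ((StrongDual.mem_polarSubmodule ℂ _ _).mpr hf)
  have hadd : ∀ x z z', P (ι x) (g (z + z')) = P (ι x) (g z) + P (ι x) (g z') := fun x z z' => by
    rw [← sub_eq_zero, ← map_add, ← map_sub]
    refine hzero x _ fun j hj => ?_
    have h1 := hg (z + z') ⟨j, hj⟩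
    have h2 := hg z ⟨j, hj⟩
    have h3 := hg z' ⟨j, hj⟩
    simp only [map_add] at h1 h2 h3
    simp [h1, h2, h3]
  have hsmul : ∀ x (c : ℂ) z, P (ι x) (g (c • z)) = c • P (ι x) (g z) := fun x c z => by
    rw [← sub_eq_zero, ← map_smul, ← map_sub]
    refine hzero x _ fun j hj => ?_
    have h1 := hg (c • z) ⟨j, hj⟩
    have h2 := hg z ⟨j, hj⟩
    simp only [map_smul] at h1 h2
    simp [h1, h2]
  have hbound : ∀ x z, ‖P (ι x) (g z)‖ ≤ ‖x‖ * ‖z‖ := fun x z => by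
    refine ((P (ι x)).le_opNorm _).trans ?_
    gcongr
    · exact (hP.norm_apply_le _).trans (NormedSpace.double_dual_bound ℂ X x)
    · exact hgn z
  set π : X → StrongDual ℂ Z := fun x =>
    LinearMap.mkContinuous ⟨⟨fun z => P (ι x) (g z), hadd x⟩, hsmul x⟩ ‖x‖ (hbound x) with hπ
  have hπa : ∀ x z, π x z = P (ι x) (g z) := fun _ _ => rfl
  have hπn : ∀ x, ‖π x‖ ≤ ‖x‖ := fun x => LinearMap.mkContinuous_norm_le _ (norm_nonneg _) _
  set Q : X →ₗ[ℂ] X :=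
    { toFun := fun x => (θ.symm (π x) : X)
      map_add' := fun x y => by
        have : π (x + y) = π x + π y := by ext z; simp [hπa]
        rw [this, map_add, Submodule.coe_add]
      map_smul' := fun c x => by
        have : π (c • x) = c • π x := by ext z; simp [hπa]
        rw [this, map_smul, Submodule.coe_smul, RingHom.id_apply] } with hQ
  have hQa : ∀ x, Q x = (θ.symm (π x) : X) := fun _ => rfl
  have hQJ : ∀ j : J, Q j = j := fun j => by
    have : π j = θ j := by
      ext z
      rw [hπa, apply_eq_self_of_mem_range hP.1
        (hPJ ▸ inclusionInDoubleDual_mem_polarSubmodule j.2), ← hg z j]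
      rfl
    rw [hQa, this, LinearIsometryEquiv.symm_apply_apply]
  refine ⟨Q, ⟨LinearMap.ext fun x => ?_, fun x => ?_⟩, le_antisymm ?_ fun j hj => ?_⟩
  · exact hQJ (θ.symm (π x))
  · rw [hQa, Submodule.norm_coe, θ.symm.norm_map]
    exact hπn x
  · rintro _ ⟨x, rfl⟩
    exact (θ.symm (π x)).2
  · exact ⟨j, hQJ ⟨j, hj⟩⟩

end OperatorSpace
end

/-! ### The pairing of `R_2[X]` with `C_2(X*)`, and uniqueness of `L`-projections -/

noncomputable section
namespace OperatorSpace

section RowProj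

variable {X : Type*} [NormedAddCommGroup X] [NormedSpace ℂ X] [OperatorSpace X]

/-- The matrix `v ⊗ w`. -/
def matTensor {V : Type*} [AddCommGroup V] [Module ℂ V] {p q : ℕ} (v : Matrix (Fin p) (Fin p) ℂ)
    (w : Matrix (Fin q) (Fin q) V) : Matrix (Fin p × Fin q) (Fin p × Fin q) V :=
  Matrix.of fun a b => v a.1 b.1 • w a.2 b.2

/-- The column `[f₀; f₁]` evaluated at `w`. -/
def colPairing {m q : ℕ} (f : Fin 2 → Matrix (Fin m) (Fin m) (StrongDual ℂ X))
    (w : Matrix (Fin q) (Fin q) X) : Matrix (Fin 2 × (Fin q × Fin m)) (Fin q × Fin m) ℂ :=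
  Matrix.of fun a b => f a.1 a.2.2 b.2 (w a.2.1 b.1)

/-- Up to reordering indices, this is the pairing of `[f₀ 0; f₁ 0]` with `w`, without its zero
columns. -/
lemma norm_colPairing_le {m q : ℕ} (f : Fin 2 → Matrix (Fin m) (Fin m) (StrongDual ℂ X))
    (w : Matrix (Fin q) (Fin q) X) : ‖colPairing f w‖ ≤ colNorm (f 0) (f 1) * matNorm q w := by
  have e : colPairing f w = (matPairing (matBlocks (f 0) 0 (f 1) 0) w).submatrix
      (fun a => (![Fin.castAdd m a.2.2, Fin.natAdd m a.2.2] a.1, a.2.1))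
      (fun b => (Fin.castAdd m b.2, b.1)) := by
    ext ⟨s, a, i⟩ ⟨b, j⟩
    fin_cases s <;>
      simp [colPairing, matPairing, matBlocks_castAdd_castAdd, matBlocks_natAdd_castAdd,
        -Fin.natAdd_eq_addNat]
  rw [e]
  refine (l2_submatrix_le _ _ _ ?_ ?_).trans (norm_matPairing_le _ w)
  · rintro ⟨s, a, i⟩ ⟨s', a', i'⟩ h
    fin_cases s <;> fin_cases s' <;>
      simp_all [Fin.ext_iff] <;> omega
  · rintro ⟨b, j⟩ ⟨b', j'⟩ h
    simp_all

/-- The duality between `R_2[X]` and `C_2(X*)` on a representation of an element. -/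
lemma norm_matPairing_add_matPairing_le {m n p q : ℕ}
    (f : Fin 2 → Matrix (Fin m) (Fin m) (StrongDual ℂ X))
    (α : Matrix (Fin n) (Fin p × Fin q) ℂ) (v : Fin 2 → Matrix (Fin p) (Fin p) ℂ)
    (w : Matrix (Fin q) (Fin q) X) (β : Matrix (Fin p × Fin q) (Fin n) ℂ) :
    ‖matPairing (f 0) (matSandwich α (matTensor (v 0) w) β) +
      matPairing (f 1) (matSandwich α (matTensor (v 1) w) β)‖ ≤
      colNorm (f 0) (f 1) * (‖α‖ * rowScalarNorm v * matNorm q w * ‖β‖) := by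
  -- The sum of the two pairings factors as `(α ⊗ 1)(v ⊗ 1)(1 ⊗ [f₀(w); f₁(w)])(β ⊗ 1)`: the sum
  -- over `Fin 2` is the product of the row `v` with the column of functionals. The submatrices only
  -- rearrange tensor factors.
  set A : Matrix (Fin n × Fin m) ((Fin p × Fin q) × Fin m) ℂ :=
    Matrix.of fun a b => if a.2 = b.2 then α a.1 b.1 else 0 with hA
  set D : Matrix ((Fin p × Fin q) × Fin m) (Fin n × Fin m) ℂ :=
    Matrix.of fun a b => if a.2 = b.2 then β a.1 b.1 else 0 with hD
  set S : Matrix (Fin p × (Fin q × Fin m)) ((Fin 2 × Fin p) × (Fin q × Fin m)) ℂ :=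
    Matrix.of fun a b => if a.2 = b.2 then
      (Matrix.of fun i (kj : Fin 2 × Fin p) => v kj.1 i kj.2 :
        Matrix (Fin p) (Fin 2 × Fin p) ℂ) a.1 b.1 else 0 with hS
  set W : Matrix ((Fin 2 × (Fin q × Fin m)) × Fin p) ((Fin q × Fin m) × Fin p) ℂ :=
    Matrix.of fun a b => if a.2 = b.2 then colPairing f w a.1 b.1 else 0 with hW
  set S' := S.submatrix (fun a : (Fin p × Fin q) × Fin m => (a.1.1, (a.1.2, a.2))) id with hS'
  set W' := W.submatrix
    (fun a : (Fin 2 × Fin p) × (Fin q × Fin m) => ((a.1.1, a.2), a.1.2))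
    (fun b : (Fin p × Fin q) × Fin m => ((b.1.2, b.2), b.1.1)) with hW'
  have hN : ∀ a b : (Fin p × Fin q) × Fin m, (S' * W') a b =
      v 0 a.1.1 b.1.1 * f 0 a.2 b.2 (w a.1.2 b.1.2) +
        v 1 a.1.1 b.1.1 * f 1 a.2 b.2 (w a.1.2 b.1.2) := by
    rintro ⟨⟨a, k⟩, i⟩ ⟨⟨b, l⟩, j⟩
    simp only [Matrix.mul_apply, hS', hW', hS, hW, Matrix.submatrix_apply, Matrix.of_apply, id,
      colPairing, ite_mul, zero_mul, mul_ite, mul_zero]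
    rw [Fintype.sum_prod_type]
    simp [Fintype.sum_prod_type, Prod.ext_iff, ite_and]
  have e : matPairing (f 0) (matSandwich α (matTensor (v 0) w) β) +
      matPairing (f 1) (matSandwich α (matTensor (v 1) w) β) =
      (A * (S' * W') * D).submatrix Prod.swap Prod.swap := by
    generalize S' * W' = N at hN
    ext ⟨i, k⟩ ⟨j, l⟩
    simp only [Matrix.add_apply, Matrix.submatrix_apply, Matrix.mul_apply, hN, hA, hD,
      Matrix.of_apply, Prod.swap_prod_mk, matPairing, matSandwich, matTensor, map_sum, map_smul,
      smul_eq_mul, Fintype.sum_prod_type (α₁ := Fin p × Fin q) (α₂ := Fin m), ite_mul, mul_ite,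
      zero_mul, mul_zero, Finset.sum_ite_eq, Finset.sum_ite_eq', Finset.mem_univ, if_true,
      Finset.sum_mul]
    conv_rhs => rw [Finset.sum_comm]
    rw [← Finset.sum_add_distrib]
    refine Finset.sum_congr rfl fun a _ => ?_
    rw [← Finset.sum_add_distrib]
    refine Finset.sum_congr rfl fun b _ => ?_
    ring
  rw [e]
  refine (l2_submatrix_le _ _ _ Prod.swap_injective Prod.swap_injective).trans ?_
  have h1 : ‖A‖ ≤ ‖α‖ := l2_kron_one_le α
  have h2 : ‖D‖ ≤ ‖β‖ := l2_kron_one_le β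
  have h3 : ‖S'‖ ≤ rowScalarNorm v := by
    refine (l2_submatrix_le _ _ _ ?_ Function.injective_id).trans (l2_kron_one_le _)
    rintro ⟨⟨a, k⟩, i⟩ ⟨⟨b, l⟩, j⟩ h
    simp_all
  have h4 : ‖W'‖ ≤ colNorm (f 0) (f 1) * matNorm q w := by
    refine (l2_submatrix_le _ _ _ ?_ ?_).trans ((l2_kron_one_le _).trans (norm_colPairing_le f w))
    · rintro ⟨⟨a, k⟩, i⟩ ⟨⟨b, l⟩, j⟩ h
      simp_all
    · rintro ⟨⟨a, k⟩, i⟩ ⟨⟨b, l⟩, j⟩ h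
      simp_all
  have h0 : 0 ≤ rowScalarNorm v := norm_nonneg _
  have h5 := (norm_nonneg W').trans h4
  calc _ ≤ ‖A‖ * (‖S'‖ * ‖W'‖) * ‖D‖ := by
        refine (Matrix.l2_opNorm_mul _ _).trans ?_
        gcongr
        refine (Matrix.l2_opNorm_mul _ _).trans ?_
        gcongr
        exact Matrix.l2_opNorm_mul _ _
    _ ≤ ‖α‖ * (rowScalarNorm v * (colNorm (f 0) (f 1) * matNorm q w)) * ‖β‖ := by gcongr
    _ = _ := by ring

/-- Every pair of matrices has a representation as in `rowProjNorm`. -/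
lemma exists_rowProj_representation {V : Type*} [AddCommGroup V] [Module ℂ V] {n : ℕ}
    (x y : Matrix (Fin n) (Fin n) V) :
    ∃ (p q : ℕ) (α : Matrix (Fin n) (Fin p × Fin q) ℂ) (v : Fin 2 → Matrix (Fin p) (Fin p) ℂ)
      (w : Matrix (Fin q) (Fin q) V) (β : Matrix (Fin p × Fin q) (Fin n) ℂ),
      x = matSandwich α (matTensor (v 0) w) β ∧ y = matSandwich α (matTensor (v 1) w) β := by
  -- With `v_s = e_ss` and `w = x ⊕ y`, the scalar matrices select the first block of `w` where `s =
  -- 0` and the second where `s = 1`.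
  refine ⟨2, n + n,
    Matrix.of fun i a => if a.2 = ![Fin.castAdd n i, Fin.natAdd n i] a.1 then 1 else 0,
    fun s => Matrix.single s s 1, matBlocks x 0 0 y,
    Matrix.of fun a i => if a.2 = ![Fin.castAdd n i, Fin.natAdd n i] a.1 then 1 else 0, ?_, ?_⟩
  · ext i j
    simp [matSandwich, matTensor, Fintype.sum_prod_type, Matrix.single_apply,
      matBlocks_castAdd_castAdd]
  · ext i j
    simp [matSandwich, matTensor, Fintype.sum_prod_type, Matrix.single_apply,
      matBlocks_natAdd_natAdd, -Fin.natAdd_eq_addNat]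

lemma norm_matPairing_add_le_rowProjNorm {m n : ℕ}
    (f : Fin 2 → Matrix (Fin m) (Fin m) (StrongDual ℂ X)) (x y : Matrix (Fin n) (Fin n) X) :
    ‖matPairing (f 0) x + matPairing (f 1) y‖ ≤ colNorm (f 0) (f 1) * rowProjNorm x y := by
  have hc : 0 ≤ colNorm (f 0) (f 1) := apply_nonneg _ _
  have hne : {r | ∃ (p q : ℕ) (α : Matrix (Fin n) (Fin p × Fin q) ℂ)
      (v : Fin 2 → Matrix (Fin p) (Fin p) ℂ) (w : Matrix (Fin q) (Fin q) X)
      (β : Matrix (Fin p × Fin q) (Fin n) ℂ),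
      x = matSandwich α (matTensor (v 0) w) β ∧ y = matSandwich α (matTensor (v 1) w) β ∧
      r = ‖α‖ * rowScalarNorm v * matNorm q w * ‖β‖}.Nonempty := by
    obtain ⟨p, q, α, v, w, β, h1, h2⟩ := exists_rowProj_representation x y
    exact ⟨_, p, q, α, v, w, β, h1, h2, rfl⟩
  have main : ∀ r : ℝ, (∃ (p q : ℕ) (α : Matrix (Fin n) (Fin p × Fin q) ℂ)
      (v : Fin 2 → Matrix (Fin p) (Fin p) ℂ) (w : Matrix (Fin q) (Fin q) X)
      (β : Matrix (Fin p × Fin q) (Fin n) ℂ),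
      x = matSandwich α (matTensor (v 0) w) β ∧ y = matSandwich α (matTensor (v 1) w) β ∧
      r = ‖α‖ * rowScalarNorm v * matNorm q w * ‖β‖) →
      ‖matPairing (f 0) x + matPairing (f 1) y‖ ≤ colNorm (f 0) (f 1) * r := by
    rintro r ⟨p, q, α, v, w, β, rfl, rfl, rfl⟩
    exact norm_matPairing_add_matPairing_le f α v w β
  rcases hc.eq_or_lt with h | h
  · obtain ⟨r, hr⟩ := hne
    simpa [← h] using main r hr
  · rw [← div_le_iff₀' h]
    refine le_csInf hne fun r hr => ?_
    rw [div_le_iff₀' h]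
    exact main r hr

/-- The dual form of a complete right `L`-projection at the level of functionals. -/
lemma IsCompleteRightLProjection.norm_add_sq_le {P : X →ₗ[ℂ] X}
    (hP : IsCompleteRightLProjection P) (f g : StrongDual ℂ X) (x : X) :
    ‖f (P x) + g (x - P x)‖ ^ 2 ≤ (‖f‖ ^ 2 + ‖g‖ ^ 2) * ‖x‖ ^ 2 := by
  have h := norm_matPairing_add_le_rowProjNorm
    ![Matrix.of fun (_ _ : Fin 1) => f, Matrix.of fun (_ _ : Fin 1) => g]
    ((Matrix.of fun (_ _ : Fin 1) => x).map P)
    ((Matrix.of fun (_ _ : Fin 1) => x) - (Matrix.of fun (_ _ : Fin 1) => x).map P)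
  rw [← hP.2, matNorm_one] at h
  have h1 := (l2_entry_le _ (0, 0) (0, 0)).trans h
  have h2 := colNorm_one_sq_le f g
  have h3 : ‖f (P x) + g (x - P x)‖ ≤ colNorm (Matrix.of fun (_ _ : Fin 1) => f)
    (Matrix.of fun (_ _ : Fin 1) => g) * ‖x‖ := h1
  calc _ ≤ (colNorm (Matrix.of fun (_ _ : Fin 1) => f)
        (Matrix.of fun (_ _ : Fin 1) => g) * ‖x‖) ^ 2 := by gcongr
    _ ≤ _ := by rw [mul_pow]; gcongr

/-- The preceding inequality with `g = 0` bounds `f (P x)` by `‖f‖ ‖x‖`. -/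
lemma IsCompleteRightLProjection.isContractiveProjection {P : X →ₗ[ℂ] X}
    (hP : IsCompleteRightLProjection P) : IsContractiveProjection P := by
  refine ⟨hP.1, fun x => NormedSpace.norm_le_dual_bound ℂ _ (norm_nonneg x) fun f => ?_⟩
  have h := hP.norm_add_sq_le f 0 x
  rw [mul_comm, ← sq_le_sq₀ (norm_nonneg _) (by positivity), mul_pow, mul_comm]
  simpa [mul_comm] using h

/-- Equal kernels give `QP = Q` and `PQ = P`, so the adjoints have equal ranges. The adjoint of `P`
satisfies the Pythagorean inequality, the adjoints therefore coincide, and functionals separate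
points. -/
theorem IsCompleteRightLProjection.eq_of_ker_eq {P Q : X →ₗ[ℂ] X}
    (hP : IsCompleteRightLProjection P) (hQ : IsContractiveProjection Q)
    (h : LinearMap.ker Q = LinearMap.ker P) : Q = P := by
  have hPc := hP.isContractiveProjection
  have hPP : ∀ x, P (P x) = P x := fun x => LinearMap.congr_fun hP.1 x
  have hQQ : ∀ x, Q (Q x) = Q x := fun x => LinearMap.congr_fun hQ.1 x
  have hQP : ∀ x, Q (P x) = Q x := fun x => by
    have : P x - x ∈ LinearMap.ker Q := by
      rw [h, LinearMap.mem_ker, map_sub, hPP, sub_self]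
    rwa [LinearMap.mem_ker, map_sub, sub_eq_zero] at this
  have hPQ : ∀ x, P (Q x) = P x := fun x => by
    have : Q x - x ∈ LinearMap.ker P := by
      rw [← h, LinearMap.mem_ker, map_sub, hQQ, sub_self]
    rwa [LinearMap.mem_ker, map_sub, sub_eq_zero] at this
  have hadj : (dualOp hPc.toCLM : StrongDual ℂ X →ₗ[ℂ] StrongDual ℂ X) = dualOp hQ.toCLM := by
    refine eq_of_range_eq_of_sq_le (isContractiveProjection_dualOp hPc).1 (fun f g => ?_)
      (isContractiveProjection_dualOp hQ) (le_antisymm ?_ ?_)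
    · set f' := dualOp hPc.toCLM f
      set g' := g - dualOp hPc.toCLM g
      have hb : ‖f' + g'‖ ≤ Real.sqrt (‖f'‖ ^ 2 + ‖g'‖ ^ 2) := by
        refine ContinuousLinearMap.opNorm_le_bound _ (Real.sqrt_nonneg _) fun x => ?_
        refine (sq_le_sq₀ (norm_nonneg _) (by positivity)).mp ?_
        rw [mul_pow, Real.sq_sqrt (by positivity)]
        -- `f'` vanishes on the range of `1 - P` and `g'` on the range of `P`.
        have e : (f' + g') x = f' (P x) + g' (x - P x) := by
          change f (P x) + (g x - g (P x)) = f (P (P x)) + (g (x - P x) - g (P (x - P x)))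
          rw [hPP, map_sub P, hPP, sub_self, map_zero, sub_zero, map_sub]
        rw [e]
        exact hP.norm_add_sq_le f' g' x
      calc _ ≤ Real.sqrt (‖f'‖ ^ 2 + ‖g'‖ ^ 2) ^ 2 := by
            gcongr
            exact hb
        _ = _ := Real.sq_sqrt (by positivity)
    · rintro _ ⟨f, rfl⟩
      exact ⟨dualOp hQ.toCLM f, by ext x; simp [hQP]⟩
    · rintro _ ⟨f, rfl⟩
      exact ⟨dualOp hPc.toCLM f, by ext x; simp [hPQ]⟩
  ext x
  refine (SeparatingDual.eq_iff_forall_dual_eq (R := ℂ)).mpr fun f => ?_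
  exact (congrArg (fun T : StrongDual ℂ X →ₗ[ℂ] StrongDual ℂ X => T f x) hadj).symm

end RowProj

end OperatorSpace
end

/-! ### The unit ball of `R_2[X]`, its dual columns, and preadjoints of `M`-projections -/

noncomputable section
namespace OperatorSpace

lemma l2_fromBlocks_le {a b c d : Type*} [Fintype a] [Fintype b] [Fintype c] [Fintype d]
    [DecidableEq a] [DecidableEq b] [DecidableEq c] [DecidableEq d] {A : Matrix a b ℂ}
    {D : Matrix c d ℂ} {C : ℝ} (hA : ‖A‖ ≤ C) (hD : ‖D‖ ≤ C) :
    ‖Matrix.fromBlocks A 0 0 D‖ ≤ C := by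
  refine l2_le_of_sq _ _ ((norm_nonneg _).trans hA) fun v => ?_
  have h1 := sq_le_l2 A (v ∘ Sum.inl)
  have h2 := sq_le_l2 D (v ∘ Sum.inr)
  simp only [Fintype.sum_sum_type, Matrix.fromBlocks_mulVec, Sum.elim_inl, Sum.elim_inr,
    Matrix.zero_mulVec, add_zero, zero_add, mul_add]
  refine add_le_add (h1.trans ?_) (h2.trans ?_) <;> simp only [Function.comp_apply] <;> gcongr

lemma matBlocks_map {V W : Type*} [Zero V] [Zero W] {m n : ℕ} (x : Matrix (Fin m) (Fin m) V) (y : Matrix (Fin n) (Fin n) V)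
    {L : V → W} (hL : L 0 = 0) :
    (matBlocks x 0 0 y).map L = matBlocks (x.map L) 0 0 (y.map L) := by
  ext i j
  refine Fin.addCases (fun i => ?_) (fun i => ?_) i <;>
    refine Fin.addCases (fun j => ?_) (fun j => ?_) j <;> simp [matBlocks, hL]

lemma addCases_injective {m n : ℕ} {T : Type*} {f : Fin m → T} {g : Fin n → T}
    (hf : Function.Injective f) (hg : Function.Injective g) (hfg : ∀ i j, f i ≠ g j) :
    Function.Injective fun i : Fin (m + n) => (Fin.addCases f g i : T) := by
  intro i j
  refine Fin.addCases (fun i => ?_) (fun i => ?_) i <;>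
    refine Fin.addCases (fun j => ?_) (fun j => ?_) j <;>
    simp only [Fin.addCases_left, Fin.addCases_right] <;> intro h
  · rw [hf h]
  · exact absurd h (hfg i j)
  · exact absurd h.symm (hfg j i)
  · rw [hg h]

section Sandwich

variable {V W : Type*} [AddCommGroup V] [Module ℂ V] [AddCommGroup W] [Module ℂ W]

lemma matSandwich_smul_right {a b c d : Type*} [Fintype b] [Fintype c] (s : ℂ)
    (α : Matrix a b ℂ) (x : Matrix b c V) (β : Matrix c d ℂ) :
    matSandwich α (s • x) β = s • matSandwich α x β :=
  (matSandwichLinear α β).map_smul s x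

lemma matSandwich_map {a b c d : Type*} [Fintype b] [Fintype c] (α : Matrix a b ℂ)
    (x : Matrix b c V) (β : Matrix c d ℂ) (L : V →ₗ[ℂ] W) :
    (matSandwich α x β).map L = matSandwich α (x.map L) β := by
  ext i j; simp [matSandwich]

lemma matSandwich_fromBlocks {a b c d a' b' c' d' : Type*} [Fintype b] [Fintype c] [Fintype b']
    [Fintype c'] (α : Matrix a b ℂ) (x : Matrix b c V) (β : Matrix c d ℂ) (α' : Matrix a' b' ℂ)
    (x' : Matrix b' c' V) (β' : Matrix c' d' ℂ) :
    matSandwich (Matrix.fromBlocks α 0 0 α') (Matrix.fromBlocks x 0 0 x')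
      (Matrix.fromBlocks β 0 0 β') =
      Matrix.fromBlocks (matSandwich α x β) 0 0 (matSandwich α' x' β') := by
  ext (i | i) (j | j) <;> simp [matSandwich]

lemma matSandwich_submatrix {a b c d a' d' : Type*} [Fintype b] [Fintype c] (α : Matrix a b ℂ)
    (x : Matrix b c V) (β : Matrix c d ℂ) (e : a' → a) (e' : d' → d) :
    matSandwich (α.submatrix e id) x (β.submatrix id e') =
      (matSandwich α x β).submatrix e e' := rfl

lemma matTensor_smul_smul {p q : ℕ} (s t : ℂ) (v : Matrix (Fin p) (Fin p) ℂ)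
    (w : Matrix (Fin q) (Fin q) V) : matTensor (s • v) (t • w) = (s * t) • matTensor v w := by
  ext a b
  simp [matTensor, smul_smul]
  ring_nf

end Sandwich

lemma rowScalarNorm_smul {p : ℕ} (s : ℂ) (v : Fin 2 → Matrix (Fin p) (Fin p) ℂ) :
    rowScalarNorm (fun k => s • v k) = ‖s‖ * rowScalarNorm v := by
  rw [rowScalarNorm, rowScalarNorm, ← norm_smul]
  rfl

/-- After regrouping columns, the row of direct sums is the block diagonal matrix of the two rows.
-/
lemma rowScalarNorm_directSum_le {p p' : ℕ} {v : Fin 2 → Matrix (Fin p) (Fin p) ℂ}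
    {v' : Fin 2 → Matrix (Fin p') (Fin p') ℂ} {C : ℝ} (hv : rowScalarNorm v ≤ C)
    (hv' : rowScalarNorm v' ≤ C) :
    rowScalarNorm (fun k => matBlocks (v k) 0 0 (v' k)) ≤ C := by
  refine le_trans (le_of_eq_of_le ?_ (l2_submatrix_le
    (Matrix.fromBlocks
      (Matrix.of fun i (kj : Fin 2 × Fin p) => v kj.1 i kj.2) 0 0
      (Matrix.of fun i (kj : Fin 2 × Fin p') => v' kj.1 i kj.2))
    finSumFinEquiv.symm
    (fun kj : Fin 2 × Fin (p + p') =>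
      Equiv.prodSumDistrib (Fin 2) (Fin p) (Fin p') (kj.1, finSumFinEquiv.symm kj.2))
    finSumFinEquiv.symm.injective ?_)) (l2_fromBlocks_le hv hv')
  · rw [rowScalarNorm]
    congr 1
    ext i ⟨k, j⟩
    refine Fin.addCases (fun i => ?_) (fun i => ?_) i <;>
      refine Fin.addCases (fun j => ?_) (fun j => ?_) j <;> simp [matBlocks]
  · rintro ⟨k, j⟩ ⟨k', j'⟩ h
    simpa using h

section RowProj

variable {X : Type*} [NormedAddCommGroup X] [NormedSpace ℂ X] [OperatorSpace X]

variable (X) in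
/-- The elements of `M_m(R_2[X])` that have a representation `α (v ⊗ w) β` with factors of norm
at most one. -/
def rowProjBall (m : ℕ) : Set (Matrix (Fin m) (Fin m) (X × X)) :=
  {u | ∃ (p q : ℕ) (α : Matrix (Fin m) (Fin p × Fin q) ℂ)
    (v : Fin 2 → Matrix (Fin p) (Fin p) ℂ) (w : Matrix (Fin q) (Fin q) X)
    (β : Matrix (Fin p × Fin q) (Fin m) ℂ),
    ‖α‖ ≤ 1 ∧ rowScalarNorm v ≤ 1 ∧ matNorm q w ≤ 1 ∧ ‖β‖ ≤ 1 ∧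
    u.map Prod.fst = matSandwich α (matTensor (v 0) w) β ∧
    u.map Prod.snd = matSandwich α (matTensor (v 1) w) β}

/-- The tensor `(v ⊕ v') ⊗ (w ⊕ w')` contains `(v ⊗ w) ⊕ (v' ⊗ w')` as a compression. The injection
`em` marks its indices, and `A`, `D` absorb the compression without increasing norms. -/
lemma directSum_mem_rowProjBall {m n : ℕ} {x : Matrix (Fin m) (Fin m) (X × X)}
    {y : Matrix (Fin n) (Fin n) (X × X)} (hx : x ∈ rowProjBall X m) (hy : y ∈ rowProjBall X n) :
    matBlocks x 0 0 y ∈ rowProjBall X (m + n) := by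
  obtain ⟨p, q, α, v, w, β, hα, hv, hw, hβ, h1, h2⟩ := hx
  obtain ⟨p', q', α', v', w', β', hα', hv', hw', hβ', h1', h2'⟩ := hy
  set em : (Fin p × Fin q) ⊕ (Fin p' × Fin q') → Fin (p + p') × Fin (q + q') :=
    Sum.elim (fun a => (Fin.castAdd p' a.1, Fin.castAdd q' a.2))
      (fun a => (Fin.natAdd p a.1, Fin.natAdd q a.2)) with hem
  have hinj : Function.Injective em := by
    rintro (⟨a, b⟩ | ⟨a, b⟩) (⟨a', b'⟩ | ⟨a', b'⟩) h <;>
      simp [hem, Fin.ext_iff] at h ⊢ <;> omega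
  set A := (Matrix.fromBlocks α 0 0 α').submatrix finSumFinEquiv.symm id *
    (1 : Matrix (Fin (p + p') × Fin (q + q')) (Fin (p + p') × Fin (q + q')) ℂ).submatrix em id
    with hA
  set D :=
    (1 : Matrix (Fin (p + p') × Fin (q + q')) (Fin (p + p') × Fin (q + q')) ℂ).submatrix id em *
      (Matrix.fromBlocks β 0 0 β').submatrix id finSumFinEquiv.symm with hD
  have key : ∀ k, matSandwich A (matTensor (matBlocks (v k) 0 0 (v' k)) (matBlocks w 0 0 w')) D =
      matBlocks (matSandwich α (matTensor (v k) w) β) 0 0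
        (matSandwich α' (matTensor (v' k) w') β') := by
    intro k
    have e : (matTensor (matBlocks (v k) 0 0 (v' k)) (matBlocks w 0 0 w')).submatrix em em =
        Matrix.fromBlocks (matTensor (v k) w) 0 0 (matTensor (v' k) w') := by
      ext (⟨a, b⟩ | ⟨a, b⟩) (⟨a', b'⟩ | ⟨a', b'⟩) <;>
        simp [hem, matTensor, matBlocks]
    rw [hA, hD, ← matSandwich_matSandwich, matSandwich_one_submatrix, e, matSandwich_submatrix,
      matSandwich_fromBlocks]
    rfl
  refine ⟨p + p', q + q', A, fun k => matBlocks (v k) 0 0 (v' k), matBlocks w 0 0 w', D,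
    ?_, rowScalarNorm_directSum_le hv hv', ?_, ?_, ?_, ?_⟩
  · refine (Matrix.l2_opNorm_mul _ _).trans (mul_le_one₀ ?_ (norm_nonneg _)
      (l2_one_submatrix_le _ _ hinj Function.injective_id))
    exact (l2_submatrix_le _ _ _ finSumFinEquiv.symm.injective Function.injective_id).trans
      (l2_fromBlocks_le hα hα')
  · rw [matNorm_directSum]
    exact max_le hw hw'
  · refine (Matrix.l2_opNorm_mul _ _).trans (mul_le_one₀
      (l2_one_submatrix_le _ _ Function.injective_id hinj) (norm_nonneg _) ?_)
    exact (l2_submatrix_le _ _ _ Function.injective_id finSumFinEquiv.symm.injective).trans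
      (l2_fromBlocks_le hβ hβ')
  · rw [key 0, ← h1, ← h1', matBlocks_map _ _ rfl]
  · rw [key 1, ← h2, ← h2', matBlocks_map _ _ rfl]

variable (X) in
lemma isMatrixConvex_rowProjBall : IsMatrixConvex (rowProjBall X) where
  directSum := directSum_mem_rowProjBall
  sandwich := by
    rintro m n α' x β' hα' hβ' ⟨p, q, α, v, w, β, hα, hv, hw, hβ, h1, h2⟩
    refine ⟨p, q, α' * α, v, w, β * β',
      (Matrix.l2_opNorm_mul _ _).trans (mul_le_one₀ hα' (norm_nonneg _) hα), hv, hw,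
      (Matrix.l2_opNorm_mul _ _).trans (mul_le_one₀ hβ (norm_nonneg _) hβ'), ?_, ?_⟩
    · rw [← matSandwich_matSandwich, ← h1]
      exact matSandwich_map α' x β' (LinearMap.fst ℂ X X)
    · rw [← matSandwich_matSandwich, ← h2]
      exact matSandwich_map α' x β' (LinearMap.snd ℂ X X)
  absorbing := by
    intro m x
    obtain ⟨p, q, α, v, w, β, h1, h2⟩ :=
      exists_rowProj_representation (x.map Prod.fst) (x.map Prod.snd)
    have hv0 : 0 ≤ rowScalarNorm v := norm_nonneg _
    have hw0 : 0 ≤ matNorm q w := apply_nonneg _ _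
    have hn : ∀ r : ℝ, 0 ≤ r → ‖(((1 + r)⁻¹ : ℝ) : ℂ)‖ * r ≤ 1 := fun r hr => by
      rw [Complex.norm_real, Real.norm_of_nonneg (by positivity)]
      exact inv_mul_le_one_of_le₀ (by linarith) (by positivity)
    refine ⟨(1 + ‖α‖)⁻¹ * (1 + ‖β‖)⁻¹ * ((1 + rowScalarNorm v)⁻¹ * (1 + matNorm q w)⁻¹),
      by positivity, p, q, (((1 + ‖α‖)⁻¹ : ℝ) : ℂ) • α,
      fun k => (((1 + rowScalarNorm v)⁻¹ : ℝ) : ℂ) • v k,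
      (((1 + matNorm q w)⁻¹ : ℝ) : ℂ) • w, (((1 + ‖β‖)⁻¹ : ℝ) : ℂ) • β, ?_, ?_, ?_, ?_, ?_, ?_⟩
    · rw [norm_smul]; exact hn _ (norm_nonneg _)
    · rw [rowScalarNorm_smul]; exact hn _ hv0
    · rw [map_smul_eq_mul]; exact hn _ hw0
    · rw [norm_smul]; exact hn _ (norm_nonneg _)
    · rw [matTensor_smul_smul, matSandwich_smul_smul, matSandwich_smul_right, ← h1, smul_smul]
      push_cast
      rfl
    · rw [matTensor_smul_smul, matSandwich_smul_smul, matSandwich_smul_right, ← h2, smul_smul]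
      push_cast
      rfl

/-- A bound for the projective norm from a bound for a multiple. -/
lemma rowProjNorm_le_of_smul_mem {n : ℕ} {x y : Matrix (Fin n) (Fin n) X} {c : ℝ} (hc : 0 < c)
    (h : (c : ℂ) • (Matrix.of fun i j => (x i j, y i j)) ∈ rowProjBall X n) :
    rowProjNorm x y ≤ c⁻¹ := by
  obtain ⟨p, q, α, v, w, β, hα, hv, hw, hβ, h1, h2⟩ := h
  have hc' : ((c⁻¹ : ℝ) : ℂ) * (c : ℂ) = 1 := by
    rw [← Complex.ofReal_mul, inv_mul_cancel₀ hc.ne', Complex.ofReal_one]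
  have hv0 : 0 ≤ rowScalarNorm v := norm_nonneg _
  have hw0 : 0 ≤ matNorm q w := apply_nonneg _ _
  have e1 : x = matSandwich (((c⁻¹ : ℝ) : ℂ) • α) (matTensor (v 0) w) ((1 : ℂ) • β) := by
    rw [matSandwich_smul_smul, ← h1, mul_one]
    ext i j
    change x i j = ((c⁻¹ : ℝ) : ℂ) • ((c : ℂ) • x i j)
    rw [smul_smul, hc', one_smul]
  have e2 : y = matSandwich (((c⁻¹ : ℝ) : ℂ) • α) (matTensor (v 1) w) ((1 : ℂ) • β) := by
    rw [matSandwich_smul_smul, ← h2, mul_one]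
    ext i j
    change y i j = ((c⁻¹ : ℝ) : ℂ) • ((c : ℂ) • y i j)
    rw [smul_smul, hc', one_smul]
  unfold rowProjNorm
  refine le_trans (csInf_le ⟨0, ?_⟩ ⟨p, q, _, v, w, _, e1, e2, rfl⟩) ?_
  · rintro r ⟨p, q, α, v, w, β, -, -, rfl⟩
    have hv0 : 0 ≤ rowScalarNorm v := norm_nonneg _
    have hw0 : 0 ≤ matNorm q w := apply_nonneg _ _
    positivity
  · rw [one_smul, norm_smul, Complex.norm_real, Real.norm_of_nonneg (by positivity)]
    calc _ ≤ c⁻¹ * 1 * 1 * 1 * 1 := by gcongr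
      _ = _ := by ring

/-- The element of `M_2(R_2)` with `M_2(R_2) ∋ [e_1; e_0]` as its first column. -/
def flipColumn (k : Fin 2) : Matrix (Fin 2) (Fin 2) ℂ := Matrix.single (1 - k) 0 1

/-- As a `2 × 4` matrix this picks out two distinct coordinates. Tensoring it with `w` is what tests
a row of functionals as a column. -/
lemma rowScalarNorm_flipColumn_le : rowScalarNorm flipColumn ≤ 1 := by
  refine l2_le_of_sq _ _ zero_le_one fun v => ?_
  simp [Matrix.mulVec, dotProduct, flipColumn, Matrix.single_apply, Fintype.sum_prod_type]
  nlinarith [sq_nonneg ‖v (0, 1)‖, sq_nonneg ‖v (1, 1)‖]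

/-- The element `[e_1 ⊗ w 0; e_0 ⊗ w 0]` of `M_{2q}(R_2[X])`. -/
def flipTensor {q : ℕ} (w : Matrix (Fin q) (Fin q) X) :
    Matrix (Fin (2 * q)) (Fin (2 * q)) (X × X) :=
  (Matrix.of fun a b : Fin 2 × Fin q =>
    (flipColumn 0 a.1 b.1 • w a.2 b.2, flipColumn 1 a.1 b.1 • w a.2 b.2)).submatrix
    finProdFinEquiv.symm finProdFinEquiv.symm

lemma flipTensor_mem {q : ℕ} {w : Matrix (Fin q) (Fin q) X} (hw : matNorm q w ≤ 1) :
    flipTensor w ∈ rowProjBall X (2 * q) := by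
  refine ⟨2, q, (1 : Matrix (Fin 2 × Fin q) (Fin 2 × Fin q) ℂ).submatrix finProdFinEquiv.symm id,
    flipColumn, w, (1 : Matrix (Fin 2 × Fin q) (Fin 2 × Fin q) ℂ).submatrix id
      finProdFinEquiv.symm,
    l2_one_submatrix_le _ _ finProdFinEquiv.symm.injective Function.injective_id,
    rowScalarNorm_flipColumn_le, hw,
    l2_one_submatrix_le _ _ Function.injective_id finProdFinEquiv.symm.injective, ?_, ?_⟩ <;>
  · rw [matSandwich_one_submatrix]
    rfl

/-- A matrix of functionals in the polar of `rowProjBall` is a contractive column over `X*`. -/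
lemma exists_dual_column {n : ℕ} (f : Matrix (Fin n) (Fin n) (X × X →ₗ[ℂ] ℂ))
    (hf : ∀ m, ∀ u ∈ rowProjBall X m, ‖matEval f u‖ ≤ 1) :
    ∃ g h : Matrix (Fin n) (Fin n) (StrongDual ℂ X), colNorm h g ≤ 1 ∧
      ∀ i j x y, f i j (x, y) = g i j x + h i j y := by
  have hent : ∀ {q : ℕ} (w : Matrix (Fin q) (Fin q) X) (i j : Fin n) (a b : Fin 2 × Fin q),
      matEval f (flipTensor w) (i, finProdFinEquiv a) (j, finProdFinEquiv b) =
        f i j (flipColumn 0 a.1 b.1 • w a.2 b.2, flipColumn 1 a.1 b.1 • w a.2 b.2) := by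
    intro q w i j a b
    simp only [matEval, flipTensor, Matrix.of_apply, Matrix.submatrix_apply,
      Equiv.symm_apply_apply]
  have hg : ∀ i j v, ‖v‖ ≤ 1 → ‖(f i j ∘ₗ LinearMap.inl ℂ X X) v‖ ≤ 1 := fun i j v hv => by
    have h1 := (l2_entry_le _ (i, finProdFinEquiv (1, 0)) (j, finProdFinEquiv (0, 0))).trans
      (hf _ _ (flipTensor_mem (w := Matrix.of fun (_ _ : Fin 1) => v) (by rwa [matNorm_one])))
    rw [hent] at h1
    simpa [flipColumn, Matrix.single_apply] using h1
  have hh : ∀ i j v, ‖v‖ ≤ 1 → ‖(f i j ∘ₗ LinearMap.inr ℂ X X) v‖ ≤ 1 := fun i j v hv => by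
    have h1 := (l2_entry_le _ (i, finProdFinEquiv (0, 0)) (j, finProdFinEquiv (0, 0))).trans
      (hf _ _ (flipTensor_mem (w := Matrix.of fun (_ _ : Fin 1) => v) (by rwa [matNorm_one])))
    rw [hent] at h1
    simpa [flipColumn, Matrix.single_apply] using h1
  refine ⟨Matrix.of fun i j => unitBallFunctional _ (hg i j),
    Matrix.of fun i j => unitBallFunctional _ (hh i j), ?_, fun i j x y => ?_⟩
  · refine sSup_dualNormSet_le _ _ zero_le_one fun q w hw => ?_
    -- Row `0` of `flipColumn` is `e_1` and row `1` is `e_0`, so its first column evaluates to `h`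
    -- above `g`; the second column supplies the zero padding in `colNorm h g`.
    refine le_trans (le_of_eq_of_le ?_ (l2_submatrix_le (matEval f (flipTensor w))
      (fun p : Fin (n + n) × Fin q => (Sum.elim id id (finSumFinEquiv.symm p.1),
        finProdFinEquiv (Sum.elim (fun _ => 0) (fun _ => 1) (finSumFinEquiv.symm p.1), p.2)))
      (fun p : Fin (n + n) × Fin q => (Sum.elim id id (finSumFinEquiv.symm p.1),
        finProdFinEquiv (Sum.elim (fun _ => 0) (fun _ => 1) (finSumFinEquiv.symm p.1), p.2)))
      ?_ ?_)) (hf _ _ (flipTensor_mem hw))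
    · congr 1
      ext ⟨i, a⟩ ⟨j, b⟩
      rw [Matrix.submatrix_apply, hent]
      refine Fin.addCases (fun i => ?_) (fun i => ?_) i <;>
        refine Fin.addCases (fun j => ?_) (fun j => ?_) j <;>
        simp [matPairing, matBlocks, flipColumn, unitBallFunctional_apply,
          -Fin.natAdd_eq_addNat] <;>
        exact (map_zero (f i j)).symm
    all_goals
      rintro ⟨i, a⟩ ⟨j, b⟩ h
      obtain ⟨i, rfl⟩ := finSumFinEquiv.surjective i
      obtain ⟨j, rfl⟩ := finSumFinEquiv.surjective j
      rcases i with i | i <;> rcases j with j | j <;>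
        simp only [Equiv.symm_apply_apply, Sum.elim_inl, Sum.elim_inr, Prod.mk.injEq, id,
          EmbeddingLike.apply_eq_iff_eq] at h <;>
        obtain ⟨h1, h2, h3⟩ := h <;>
        first
          | exact absurd h2 (by decide)
          | rw [h1, h3]
  · simp only [Matrix.of_apply, unitBallFunctional_apply, LinearMap.comp_apply,
      LinearMap.inl_apply, LinearMap.inr_apply, ← map_add, Prod.mk_add_mk, add_zero, zero_add]

/-- A complete left `M`-projection is contractive as a diagonal map on columns. -/
lemma IsCompleteLeftMProjection.colNorm_le {P : X →ₗ[ℂ] X} (hP : IsCompleteLeftMProjection P)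
    {n : ℕ} (x y : Matrix (Fin n) (Fin n) X) :
    colNorm (x.map P) (y - y.map P) ≤ colNorm x y := by
  -- The `M`-projection identity for `[x; y]` gives a column with entries `Px, Py, x - Px, y - Py`;
  -- the first and last are kept.
  set M : Matrix (Fin (n + n)) (Fin (n + n)) X := matBlocks x 0 y 0 with hM
  have e : matBlocks (x.map P) 0 (y - y.map P) 0 =
      (matBlocks (M.map P) 0 (M - M.map P) 0).submatrix
        (fun i => Fin.addCases (fun i => Fin.castAdd (n + n) (Fin.castAdd n i))
          (fun i => Fin.natAdd (n + n) (Fin.natAdd n i)) i)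
        (fun j => Fin.castAdd (n + n) j) := by
    ext i j
    refine Fin.addCases (fun i => ?_) (fun i => ?_) i <;>
      refine Fin.addCases (fun j => ?_) (fun j => ?_) j <;>
      simp only [Matrix.submatrix_apply, Fin.addCases_left, Fin.addCases_right, hM,
        matBlocks_castAdd_castAdd, matBlocks_castAdd_natAdd, matBlocks_natAdd_castAdd,
        matBlocks_natAdd_natAdd, Matrix.map_apply, Matrix.sub_apply, Matrix.zero_apply, map_zero,
        sub_zero]
  have h2 : colNorm x y = matNorm (n + n + (n + n)) (matBlocks (M.map P) 0 (M - M.map P) 0) :=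
    hP.2 (n + n) M
  rw [h2, colNorm, e]
  refine matNorm_submatrix_le _ (addCases_injective
    ((Fin.castAdd_injective _ _).comp (Fin.castAdd_injective _ _))
    ((Fin.natAdd_injective _ _).comp (Fin.natAdd_injective _ _)) fun i j h => ?_)
    (Fin.castAdd_injective _ _)
  have := congrArg Fin.val h
  simp at this
  omega

lemma colNorm_swap_le {n : ℕ} (x y : Matrix (Fin n) (Fin n) X) : colNorm x y ≤ colNorm y x := by
  have e : matBlocks x 0 y 0 = (matBlocks y 0 x 0).submatrix
      (fun i => Fin.addCases (fun i => Fin.natAdd n i) (fun i => Fin.castAdd n i) i) id := by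
    ext i j
    refine Fin.addCases (fun i => ?_) (fun i => ?_) i <;>
      refine Fin.addCases (fun j => ?_) (fun j => ?_) j <;>
      simp only [Matrix.submatrix_apply, Fin.addCases_left, Fin.addCases_right, id,
        matBlocks_castAdd_castAdd, matBlocks_castAdd_natAdd, matBlocks_natAdd_castAdd,
        matBlocks_natAdd_natAdd, Matrix.zero_apply]
  rw [colNorm, e]
  refine matNorm_submatrix_le _ (addCases_injective (Fin.natAdd_injective _ _)
    (Fin.castAdd_injective _ _) fun i j h => ?_) Function.injective_id
  have := congrArg Fin.val h
  simp at this
  omega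

lemma rowProjNorm_nonneg {n : ℕ} (x y : Matrix (Fin n) (Fin n) X) : 0 ≤ rowProjNorm x y := by
  refine Real.sInf_nonneg ?_
  rintro r ⟨p, q, α, v, w, β, -, -, rfl⟩
  have hv0 : 0 ≤ rowScalarNorm v := norm_nonneg _
  have hw0 : 0 ≤ matNorm q w := apply_nonneg _ _
  positivity

/-- The dual description of the projective norm. -/
lemma exists_dual_column_ge {n : ℕ} (x y : Matrix (Fin n) (Fin n) X) {ε : ℝ} (hε : 0 < ε) :
    ∃ g h : Matrix (Fin n) (Fin n) (StrongDual ℂ X), colNorm h g ≤ 1 ∧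
      rowProjNorm x y ≤ ‖matPairing g x + matPairing h y‖ * (1 + ε) := by
  rcases (rowProjNorm_nonneg x y).eq_or_lt with h | h
  · refine ⟨0, 0, ?_, by rw [← h]; positivity⟩
    have : matBlocks (0 : Matrix (Fin n) (Fin n) (StrongDual ℂ X)) 0 0
        (0 : Matrix (Fin n) (Fin n) (StrongDual ℂ X)) = 0 := by
      simp [matBlocks]
    rw [colNorm, this, map_zero]
    exact zero_le_one
  set r := rowProjNorm x y with hr
  obtain ⟨f, hf, hfx⟩ := (isMatrixConvex_rowProjBall X).exists_matEval_separating
    (x₀ := ((r⁻¹ : ℝ) : ℂ) • Matrix.of fun i j => (x i j, y i j)) (fun c hc hcx => by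
      rw [smul_smul, ← Complex.ofReal_mul] at hcx
      have h1 := rowProjNorm_le_of_smul_mem (by positivity) hcx
      rw [← hr, mul_inv, inv_inv, ← div_eq_inv_mul, le_div_iff₀ hc] at h1
      nlinarith) hε
  obtain ⟨g, k, hgk, hfgk⟩ := exists_dual_column f hf
  refine ⟨g, k, hgk, ?_⟩
  have e : matEval f (((r⁻¹ : ℝ) : ℂ) • Matrix.of fun i j => (x i j, y i j)) =
      ((r⁻¹ : ℝ) : ℂ) • (matPairing g x + matPairing k y) := by
    ext p q
    simp only [matEval, matPairing, Matrix.of_apply, Matrix.smul_apply, Matrix.add_apply,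
      Prod.smul_mk, map_smul, smul_add, hfgk]
  rw [e, norm_smul, Complex.norm_real, Real.norm_of_nonneg (by positivity), mul_assoc,
    ← div_eq_inv_mul, le_div_iff₀ h, one_mul] at hfx
  exact hfx

/-- If the adjoint of `R` is a complete left `M`-projection, then `1 - R` is a complete right
`L`-projection. -/
theorem isCompleteRightLProjection_of_dualOp {R : X →L[ℂ] X} (hRR : ∀ x, R (R x) = R x)
    (hP : IsCompleteLeftMProjection (X := StrongDual ℂ X) (dualOp R).toLinearMap) :
    IsCompleteRightLProjection ((LinearMap.id : X →ₗ[ℂ] X) - R.toLinearMap) := by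
  refine ⟨?_, fun n x => ?_⟩
  · ext x; simp [hRR]
  have e1 : x.map ((LinearMap.id : X →ₗ[ℂ] X) - R.toLinearMap) = x - x.map R := by ext i j; simp
  have e2 : x - (x - x.map R) = x.map R := by simp
  rw [e1, e2]
  refine le_antisymm (matNorm_le_of_matPairing_le x fun m f hf => ?_) ?_
  · have h := norm_matPairing_add_le_rowProjNorm
      ![f - f.map (dualOp R), f.map (dualOp R)] (x - x.map R) (x.map R)
    have e : matPairing f x = matPairing (f - f.map (dualOp R)) (x - x.map R) +
        matPairing (f.map (dualOp R)) (x.map R) := by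
      ext p q
      simp [matPairing, hRR]
    rw [e]
    refine h.trans (mul_le_of_le_one_left (rowProjNorm_nonneg _ _) ?_)
    exact (colNorm_swap_le _ _).trans ((hP.2 m f).symm.le.trans hf)
  · have lim : Filter.Tendsto (fun δ : ℝ => matNorm n x * (1 + δ))
        (nhdsWithin 0 (Set.Ioi 0)) (nhds (matNorm n x * (1 + 0))) :=
      (Continuous.tendsto (by fun_prop) 0).mono_left nhdsWithin_le_nhds
    rw [add_zero, mul_one] at lim
    refine ge_of_tendsto lim ?_
    filter_upwards [self_mem_nhdsWithin] with δ hδ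
    have hδ : 0 < δ := hδ
    obtain ⟨g, h, hgh, hle⟩ := exists_dual_column_ge (x - x.map R) (x.map R) hδ
    refine hle.trans ?_
    gcongr
    -- The norming column collapses to one matrix `F` with the same value at `x`. Its norm is that
    -- of the column `[R*h; g - R*g]`, which is at most that of `[h; g]`.
    set F : Matrix (Fin n) (Fin n) (StrongDual ℂ X) :=
      (g - g.map (dualOp R)) + h.map (dualOp R) with hF
    have e : matPairing g (x - x.map R) + matPairing h (x.map R) = matPairing F x := by
      ext p q
      simp [matPairing, hF]
    have hF1 : F.map (dualOp R).toLinearMap = h.map (dualOp R).toLinearMap := by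
      ext i j y
      simp [hF, hRR]
    have hF2 : F - h.map (dualOp R).toLinearMap = g - g.map (dualOp R).toLinearMap := by
      rw [hF]; exact add_sub_cancel_right _ _
    have hFn : matNorm n F ≤ 1 := by
      rw [hP.2 n F, hF1, hF2]
      exact (hP.colNorm_le h g).trans hgh
    rw [e]
    exact (norm_matPairing_le F x).trans (mul_le_of_le_one_left (apply_nonneg _ _) hFn)

end RowProj

end OperatorSpace
end

/-! ### Weak*-closed ideals in dual operator spaces -/

noncomputable section
namespace OperatorSpace

/-- A closed subspace of a locally convex space is separated from points outside of it. -/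
lemma exists_dual_eq_zero_ne_zero {E : Type*} [AddCommGroup E] [TopologicalSpace E] [Module ℝ E]
    [Module ℂ E] [IsScalarTower ℝ ℂ E] [IsTopologicalAddGroup E] [ContinuousSMul ℂ E]
    [LocallyConvexSpace ℝ E] {S : Submodule ℂ E} (hS : IsClosed (S : Set E)) {x : E}
    (hx : x ∉ S) : ∃ f : StrongDual ℂ E, (∀ s ∈ S, f s = 0) ∧ f x ≠ 0 := by
  obtain ⟨f, u, hf, hu⟩ := RCLike.geometric_hahn_banach_closed_point (𝕜 := ℂ)
    (S.restrictScalars ℝ).convex hS hx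
  have hu0 : 0 < u := by simpa using hf 0 S.zero_mem
  refine ⟨f, fun s hs => ?_, fun h => ?_⟩
  · by_contra hne
    -- If `f s ≠ 0`, this multiple of `s` takes the value `u`, against the strict bound on the
    -- subspace.
    have h1 := hf (((u : ℂ) / f s) • s) (S.smul_mem _ hs)
    rw [map_smul, smul_eq_mul, div_mul_cancel₀ _ hne] at h1
    simp at h1
  · rw [h, map_zero] at hu
    linarith

/-- A weak*-closed subspace of a dual is the annihilator of its pre-annihilator. -/
lemma mem_of_isClosed_weakDual {Y : Type*} [NormedAddCommGroup Y] [NormedSpace ℂ Y]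
    {S : Submodule ℂ (WeakDual ℂ Y)} (hS : IsClosed (S : Set (WeakDual ℂ Y)))
    {f : WeakDual ℂ Y} (hf : ∀ y : Y, (∀ g ∈ S, g y = 0) → f y = 0) : f ∈ S := by
  by_contra hne
  obtain ⟨φ, hφ, hφf⟩ :=
    exists_dual_eq_zero_ne_zero (E := WeakBilin (topDualPairing ℂ Y)) (S := S) hS hne
  obtain ⟨y, rfl⟩ := LinearMap.dualEmbedding_surjective (topDualPairing ℂ Y) φ
  exact hφf (hf y fun g hg => hφ g hg)

variable {X : Type*} [NormedAddCommGroup X] [NormedSpace ℂ X]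

section Dual

variable {Y : Type*} [NormedAddCommGroup Y] [NormedSpace ℂ Y]

/-- The elements of `Y` as functionals on a space that is identified with `Y*`. -/
def predualMap (ε : X ≃ₗᵢ[ℂ] StrongDual ℂ Y) : Y →ₗᵢ[ℂ] StrongDual ℂ X where
  toFun y := (NormedSpace.inclusionInDoubleDual ℂ Y y).comp
    (ε.toContinuousLinearEquiv : X →L[ℂ] StrongDual ℂ Y)
  map_add' y z := by ext x; simp
  map_smul' c y := by ext x; simp
  norm_map' y := by
    refine le_antisymm (ContinuousLinearMap.opNorm_le_bound _ (norm_nonneg _) fun x => ?_)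
      (NormedSpace.norm_le_dual_bound ℂ y (norm_nonneg _) fun f => ?_)
    · refine ((ε x).le_opNorm y).trans ?_
      rw [ε.norm_map, mul_comm]
    · have h := ContinuousLinearMap.le_opNorm ((NormedSpace.inclusionInDoubleDual ℂ Y y).comp
        (ε.toContinuousLinearEquiv : X →L[ℂ] StrongDual ℂ Y)) (ε.symm f)
      rw [ε.symm.norm_map] at h
      simpa using h

/-- The restriction `X** = Y*** → Y* = X`. -/
def bidualRestrict (ε : X ≃ₗᵢ[ℂ] StrongDual ℂ Y) : StrongDual ℂ (StrongDual ℂ X) →ₗ[ℂ] X where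
  toFun F := ε.symm (F.comp (predualMap ε).toContinuousLinearMap)
  map_add' F G := by rw [ContinuousLinearMap.add_comp, map_add]
  map_smul' c F := by rw [ContinuousLinearMap.smul_comp, map_smul, RingHom.id_apply]

variable (ε : X ≃ₗᵢ[ℂ] StrongDual ℂ Y)

lemma apply_bidualRestrict (F : StrongDual ℂ (StrongDual ℂ X)) (y : Y) :
    ε (bidualRestrict ε F) y = F (predualMap ε y) := by
  change ε (ε.symm (F.comp (predualMap ε).toContinuousLinearMap)) y = _
  rw [ε.apply_symm_apply]
  rfl

lemma bidualRestrict_eq_zero {F : StrongDual ℂ (StrongDual ℂ X)}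
    (hF : ∀ y, F (predualMap ε y) = 0) : bidualRestrict ε F = 0 := by
  refine ε.injective ?_
  ext y
  rw [apply_bidualRestrict, hF, map_zero]
  rfl

lemma bidualRestrict_inclusionInDoubleDual (x : X) :
    bidualRestrict ε (NormedSpace.inclusionInDoubleDual ℂ X x) = x := by
  refine ε.injective ?_
  ext y
  rw [apply_bidualRestrict]
  rfl

lemma norm_bidualRestrict_le (F : StrongDual ℂ (StrongDual ℂ X)) :
    ‖bidualRestrict ε F‖ ≤ ‖F‖ := by
  rw [← ε.norm_map]
  refine ContinuousLinearMap.opNorm_le_bound _ F.opNorm_nonneg fun y => ?_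
  rw [apply_bidualRestrict, ← (predualMap ε).norm_map y]
  exact F.le_opNorm _

/-- Any `y ∈ Y` that annihilates `J` lies in `J^⊥`, so `F` kills it. A weak*-closed subspace is
determined by such `y`. -/
lemma bidualRestrict_mem {J : Submodule ℂ X}
    (hJ : IsClosed ((fun x => StrongDual.toWeakDual (ε x)) '' (J : Set X)))
    {F : StrongDual ℂ (StrongDual ℂ X)}
    (hF : F ∈ StrongDual.polarSubmodule ℂ (StrongDual.polarSubmodule ℂ J)) :
    bidualRestrict ε F ∈ J := by
  set S : Submodule ℂ (WeakDual ℂ Y) :=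
    J.map (StrongDual.toWeakDual.toLinearMap ∘ₗ ε.toLinearEquiv.toLinearMap) with hS
  have hmem : StrongDual.toWeakDual (ε (bidualRestrict ε F)) ∈ S := by
    refine mem_of_isClosed_weakDual (by rw [hS, Submodule.map_coe]; exact hJ) fun y hy => ?_
    change ε (bidualRestrict ε F) y = 0
    rw [apply_bidualRestrict]
    refine (StrongDual.mem_polarSubmodule ℂ _ _).mp hF _
      ((StrongDual.mem_polarSubmodule ℂ _ _).mpr fun j hj => ?_)
    exact hy _ ⟨j, hj, rfl⟩
  obtain ⟨j, hj, hje⟩ := hmem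
  have : j = bidualRestrict ε F := ε.injective (StrongDual.toWeakDual.injective hje)
  rwa [← this]

variable [OperatorSpace X]

/-- The bidual projection of a weak*-closed ideal commutes with the restriction to `X`. -/
lemma bidualRestrict_apply_eq_zero {J : Submodule ℂ X}
    (hJ : IsClosed ((fun x => StrongDual.toWeakDual (ε x)) '' (J : Set X)))
    {P : StrongDual ℂ (StrongDual ℂ X) →ₗ[ℂ] StrongDual ℂ (StrongDual ℂ X)}
    (hP : IsCompleteLeftMProjection (X := StrongDual ℂ (StrongDual ℂ X)) P)
    (hPJ : LinearMap.range P =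
      StrongDual.polarSubmodule ℂ (StrongDual.polarSubmodule ℂ J))
    {F : StrongDual ℂ (StrongDual ℂ X)} (hF : bidualRestrict ε F = 0) :
    bidualRestrict ε (P F) = 0 := by
  set g := bidualRestrict ε (P F) with hg
  have hgJ : g ∈ J := bidualRestrict_mem ε hJ (hPJ ▸ ⟨F, rfl⟩)
  set G := NormedSpace.inclusionInDoubleDual ℂ X g with hG
  have hPG : P G = G :=
    apply_eq_self_of_mem_range hP.1 (hPJ ▸ inclusionInDoubleDual_mem_polarSubmodule hgJ)
  -- This is the uniqueness argument with the restriction in the role of `Q`. As `F` restricts to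
  -- `0`, `F - P F` restricts to `-g`, so the coefficient `-s` makes the two terms reinforce each
  -- other.
  have key : ∀ s : ℝ, 0 ≤ s → (s + 1) ^ 2 * ‖g‖ ^ 2 ≤ s ^ 2 * ‖g‖ ^ 2 + ‖F - P F‖ ^ 2 := by
    intro s hs
    have h1 := hP.sq_le (((-s : ℝ) : ℂ) • G) F
    rw [map_smul, hPG] at h1
    have h2 : ‖((-s : ℝ) : ℂ) • G‖ ≤ s * ‖g‖ := by
      rw [hG, ← map_smul]
      refine (NormedSpace.double_dual_bound ℂ X _).trans_eq ?_
      rw [norm_smul, Complex.norm_real, norm_neg, Real.norm_of_nonneg hs]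
    have h3 : bidualRestrict ε (((-s : ℝ) : ℂ) • G + (F - P F)) = ((-(s + 1) : ℝ) : ℂ) • g := by
      rw [map_add, map_smul, (bidualRestrict ε).map_sub F (P F), hF, ← hg, hG, bidualRestrict_inclusionInDoubleDual]
      push_cast
      module
    have h4 := norm_bidualRestrict_le ε (((-s : ℝ) : ℂ) • G + (F - P F))
    rw [h3, norm_smul, Complex.norm_real, norm_neg, Real.norm_of_nonneg (by positivity)] at h4
    calc _ = ((s + 1) * ‖g‖) ^ 2 := by ring
      _ ≤ ‖((-s : ℝ) : ℂ) • G + (F - P F)‖ ^ 2 := by gcongr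
      _ ≤ _ := h1
      _ ≤ (s * ‖g‖) ^ 2 + ‖F - P F‖ ^ 2 := by gcongr
      _ = _ := by ring
  by_contra hne
  have hpos : 0 < ‖g‖ ^ 2 := by positivity
  have := key (‖F - P F‖ ^ 2 / ‖g‖ ^ 2) (by positivity)
  have e : ‖F - P F‖ ^ 2 / ‖g‖ ^ 2 * ‖g‖ ^ 2 = ‖F - P F‖ ^ 2 := by field_simp
  nlinarith [sq_nonneg ‖F - P F‖]

/-- A weak*-closed complete right `M`-ideal is the range of a contractive projection that has a
preadjoint. -/
theorem IsCompleteRightMIdeal.exists_preadjoint [CompleteSpace Y] {J : Submodule ℂ X}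
    (hI : IsCompleteRightMIdeal J)
    (hJ : IsClosed ((fun x => StrongDual.toWeakDual (ε x)) '' (J : Set X))) :
    ∃ (Q : X →ₗ[ℂ] X) (R : Y →L[ℂ] Y), IsContractiveProjection Q ∧ LinearMap.range Q = J ∧
      ∀ x y, ε (Q x) y = ε x (R y) := by
  obtain ⟨-, P, hP, hPJ⟩ := hI
  set Q : X →ₗ[ℂ] X := bidualRestrict ε ∘ₗ P ∘ₗ
    (NormedSpace.inclusionInDoubleDual ℂ X).toLinearMap with hQ
  have hQa : ∀ x, Q x = bidualRestrict ε (P (NormedSpace.inclusionInDoubleDual ℂ X x)) :=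
    fun _ => rfl
  have hQmem : ∀ x, Q x ∈ J := fun x => bidualRestrict_mem ε hJ (hPJ ▸ ⟨_, rfl⟩)
  have hQJ : ∀ j ∈ J, Q j = j := fun j hj => by
    rw [hQa, apply_eq_self_of_mem_range hP.1
      (hPJ ▸ inclusionInDoubleDual_mem_polarSubmodule hj), bidualRestrict_inclusionInDoubleDual]
  have hQr : LinearMap.range Q = J := by
    refine le_antisymm ?_ fun j hj => ⟨j, hQJ j hj⟩
    rintro _ ⟨x, rfl⟩
    exact hQmem x
  have hQc : IsContractiveProjection Q := by
    refine ⟨LinearMap.ext fun x => hQJ _ (hQmem x), fun x => ?_⟩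
    exact (norm_bidualRestrict_le ε _).trans ((hP.norm_apply_le _).trans
      (NormedSpace.double_dual_bound ℂ X x))
  have hPQ := dualOp_dualOp_eq hP hQc (by rw [hPJ, hQr])
  have hclosed : IsClosed (LinearMap.range (predualMap ε).toLinearMap : Set (StrongDual ℂ X)) := by
    rw [LinearMap.coe_range]
    exact (predualMap ε).isometry.isClosedEmbedding.isClosed_range
  -- If `Q*y` were outside the closed copy of `Y`, some `F` vanishing on `Y` would be nonzero at it.
  -- But `F` restricts to `0`, hence so does `P F = Q**F`, and this says `F (Q*y) = 0`.
  have hex : ∀ y, ∃ z, predualMap ε z = dualOp hQc.toCLM (predualMap ε y) := fun y => by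
    by_contra hne
    obtain ⟨F, hF, hFy⟩ := exists_dual_eq_zero_ne_zero hclosed
      (x := dualOp hQc.toCLM (predualMap ε y)) (fun ⟨z, hz⟩ => hne ⟨z, hz⟩)
    have h1 := bidualRestrict_apply_eq_zero ε hJ hP hPJ
      (bidualRestrict_eq_zero ε fun z => hF _ ⟨z, rfl⟩)
    have h2 := apply_bidualRestrict ε (P F) y
    rw [h1, hPQ] at h2
    refine hFy ?_
    simpa using h2.symm
  choose R hR using hex
  have hRa : ∀ x y, ε (Q x) y = ε x (R y) := fun x y =>
    (congrArg (fun f : StrongDual ℂ X => f x) (hR y)).symm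
  have hRn : ∀ y, ‖R y‖ ≤ 1 * ‖y‖ := fun y => by
    rw [one_mul, ← (predualMap ε).norm_map, hR, ← (predualMap ε).norm_map y]
    exact (isContractiveProjection_dualOp hQc).2 _
  refine ⟨Q, LinearMap.mkContinuous ⟨⟨R, fun y z => ?_⟩, fun c y => ?_⟩ 1 hRn, hQc, hQr, hRa⟩
  · refine (predualMap ε).injective ?_
    rw [map_add, hR, hR, hR, map_add, map_add]
  · refine (predualMap ε).injective ?_
    rw [map_smul, hR, hR, map_smul, map_smul, RingHom.id_apply]

end Dual

variable [OperatorSpace X]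

lemma IsCompleteIsometry.norm_map {Y : Type*} [NormedAddCommGroup Y] [NormedSpace ℂ Y]
    [OperatorSpace Y] {e : X →ₗ[ℂ] Y} (he : IsCompleteIsometry e) (x : X) : ‖e x‖ = ‖x‖ := by
  have h := he 1 (Matrix.of fun _ _ => x)
  rw [matNorm_one] at h
  rw [← h, ← matNorm_one]
  rfl

/-- The projection `Q` onto `J` is, through `e`, the adjoint of `R`. So `R*` is a left
`M`-projection, `1 - R` is a right `L`-projection, and `e(J) = Ran R*` is the annihilator of `Ran (1
- R)`. -/
theorem IsCompleteRightMIdeal.exists_isCompleteLeftLSummand {Y : Type*} [NormedAddCommGroup Y]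
    [NormedSpace ℂ Y] [CompleteSpace Y] [OperatorSpace Y] {e : X ≃ₗ[ℂ] StrongDual ℂ Y}
    (he : IsCompleteIsometry e.toLinearMap) {J : Submodule ℂ X} (hI : IsCompleteRightMIdeal J)
    (hJ : IsClosed ((fun x => StrongDual.toWeakDual (e x)) '' (J : Set X))) :
    IsCompleteRightMSummand J ∧ ∃ K : Submodule ℂ Y, IsCompleteLeftLSummand K ∧
      J.map e.toLinearMap = StrongDual.polarSubmodule ℂ K := by
  obtain ⟨Q, R, hQ, hQJ, hQR⟩ := hI.exists_preadjoint ⟨e, he.norm_map⟩ hJ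
  replace hQR : ∀ x y, e (Q x) y = e x (R y) := hQR
  have hQQ : ∀ x, Q (Q x) = Q x := fun x => LinearMap.congr_fun hQ.1 x
  have hQM := hI.isCompleteLeftMProjection hQ hQJ
  have hext : ∀ y z : Y, (∀ x, e x y = e x z) → y = z := fun y z h =>
    (SeparatingDual.eq_iff_forall_dual_eq (R := ℂ)).mpr fun f => by
      simpa using h (e.symm f)
  have hRR : ∀ y, R (R y) = R y := fun y => hext _ _ fun x => by
    rw [← hQR, ← hQR, hQQ, hQR]
  have hdual : IsCompleteLeftMProjection (X := StrongDual ℂ Y) (dualOp R).toLinearMap := by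
    refine hQM.of_isCompleteIsometry (ι := e.symm.toLinearMap) (fun n f => ?_) fun f => ?_
    · rw [← he]
      congr 1
      ext i j
      simp
    · refine e.injective ?_
      ext y
      simp [hQR]
  have hL := isCompleteRightLProjection_of_dualOp hRR hdual
  refine ⟨⟨Q, hQM, hQJ⟩, _, ⟨_, hL, rfl⟩, ?_⟩
  ext f
  rw [StrongDual.mem_polarSubmodule]
  constructor
  · rintro ⟨j, hj, rfl⟩ _ ⟨y, rfl⟩
    obtain ⟨x, rfl⟩ := hQJ ▸ hj
    simp [hQR, hRR]
  · intro hf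
    refine ⟨Q (e.symm f), hQJ ▸ ⟨_, rfl⟩, ?_⟩
    ext y
    have h := hf (y - R y) ⟨y, by simp⟩
    rw [map_sub, sub_eq_zero] at h
    simp [hQR, h]

end OperatorSpace
end

theorem theorem3p10 {X : Type*} [NormedAddCommGroup X] [NormedSpace ℂ X] [OperatorSpace X] :
    -- (a)
    (∀ P Q : X →ₗ[ℂ] X, OperatorSpace.IsCompleteLeftMProjection P →
      OperatorSpace.IsContractiveProjection Q →
      LinearMap.range Q = LinearMap.range P → P = Q) ∧
    -- (b)
    (∀ P Q : X →ₗ[ℂ] X, OperatorSpace.IsCompleteRightLProjection P →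
      OperatorSpace.IsContractiveProjection Q →
      LinearMap.ker Q = LinearMap.ker P → Q = P) ∧
    -- (c)
    (∀ J : Submodule ℂ X, OperatorSpace.IsCompleteRightMIdeal J →
      (∃ Q : X →ₗ[ℂ] X, OperatorSpace.IsContractiveProjection Q ∧ LinearMap.range Q = J) →
      OperatorSpace.IsCompleteRightMSummand J ∧
      ∃! Q : X →ₗ[ℂ] X, OperatorSpace.IsContractiveProjection Q ∧ LinearMap.range Q = J) ∧
    -- (d)
    (∀ J : Submodule ℂ X, OperatorSpace.IsCompleteRightMIdeal J →
      ∀ (Z : Type*) [NormedAddCommGroup Z] [NormedSpace ℂ Z] [CompleteSpace Z],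
      Nonempty (J ≃ₗᵢ[ℂ] StrongDual ℂ Z) → OperatorSpace.IsCompleteRightMSummand J) ∧
    -- (e)
    (∀ (Y : Type*) [NormedAddCommGroup Y] [NormedSpace ℂ Y] [CompleteSpace Y] [OperatorSpace Y]
      (e : X ≃ₗ[ℂ] StrongDual ℂ Y), OperatorSpace.IsCompleteIsometry e.toLinearMap →
      ∀ J : Submodule ℂ X, OperatorSpace.IsCompleteRightMIdeal J →
      IsClosed ((fun x => StrongDual.toWeakDual (e x)) '' (J : Set X)) →
      OperatorSpace.IsCompleteRightMSummand J ∧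
      ∃ K : Submodule ℂ Y, OperatorSpace.IsCompleteLeftLSummand K ∧
        J.map e.toLinearMap = StrongDual.polarSubmodule ℂ K) := by
  refine ⟨fun P Q hP hQ h => hP.eq_of_range_eq hQ h, fun P Q hP hQ h => hP.eq_of_ker_eq hQ h,
    ?_, ?_, ?_⟩
  · rintro J hJ ⟨Q, hQ, hQJ⟩
    have hQM := hJ.isCompleteLeftMProjection hQ hQJ
    exact ⟨⟨Q, hQM, hQJ⟩, Q, ⟨hQ, hQJ⟩, fun Q' hQ' =>
      (hQM.eq_of_range_eq hQ'.1 (hQ'.2.trans hQJ.symm)).symm⟩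
  · rintro J hJ Z _ _ _ ⟨θ⟩
    obtain ⟨Q, hQ, hQJ⟩ := hJ.exists_isContractiveProjection θ
    exact ⟨Q, hJ.isCompleteLeftMProjection hQ hQJ, hQJ⟩
  · intro Y _ _ _ _ e he J hI hJ
    exact hI.exists_isCompleteLeftLSummand he hJ
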